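/- Let $\mathbb{Y}$ be a locally compact Hausdorff space with a countable base and with its Borel $\sigma$-field, let $\mathcal{F}$ be the set of closed subsets of $\mathbb{Y}$ with the Borel $\sigma$-field of the Fell topology (the topology generated by the sets $\{F\in\mathcal F: F\cap C=\emptyset\}$, $C\subset\mathbb{Y}$ compact, and $\{F\in\mathcal F: F\cap G\ne\emptyset\}$, $G\subset\mathbb{Y}$ open), let $\rho$ be a measure on $\mathbb{Y}$, and let $\mathcal{F}'\subset\mathcal{F}$ be a measurable set, closed under finite unions of its members, such that $\rho(K)<\infty$ for all $K\in\mathcal{F}'$ and $K\mapsto\rho(K)$ is measurable on $\mathcal{F}'$ (with the trace $\sigma$-field). Let $\Lambda$ be a $\sigma$-finite measure on $\mathcal{F}'$ with $$\int_{\mathcal{F}'}\rho(K)\,\Lambda(dK)<\infty ,$$ and let $B_n\uparrow\mathcal{F}'$ be measurable sets with $\Lambda(B_n)<\infty$ for all $n\in\mathbb{N}$. Let $\eta$ be a Poisson process on $\mathcal{F}'$ with intensity measure $\Lambda$, defined on a probability space $(\Omega,\mathcal A,\mathbb P)$ and taking values in the $\sigma$-finite measures on $\mathcal F'$ with values in $\{0,1,2,\dots,\infty\}$.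 The Boolean model is $Z:=\bigcup_{K:\,\eta(\{K\})>0}K$ if $\eta(B_n)<\infty$ for all $n$ (which holds almost surely), and $Z:=\emptyset$ otherwise. Put $F:=\mathbf 1\{\rho(Z)<\infty\}\,\rho(Z)$ (with $0\cdot\infty:=0$). Let $\tau(z):=(1-e^{-z})/z$ for $z\in(0,\infty)$, $\tau(0):=1$, $\tau(\infty):=0$; let $\mathcal{F}'_y:=\{K\in\mathcal{F}':y\in K\}$ for $y\in\mathbb Y$, $\rho^*(K):=\int_K\tau(\Lambda(\mathcal{F}'_y))\,\rho(dy)$ for $K\in\mathcal F'$, and define a measure on $[0,\infty)$ by $$\nu^*:=\int_{\mathcal{F}'}\mathbf{1}\{\rho(K)\in\cdot\}\,\frac{\rho^*(K)}{\rho(K)}\,\Lambda(dK),\qquad \tfrac00:=0 .$$ Let $\phi(z):=e^z-1-z$ and $$s_0:=\sup\Big\{s>0:\int_{\mathcal{F}'}\mathbf{1}\{\rho(K)>1\}\,e^{s\rho(K)}\,\Lambda(dK)<\infty\Big\}\in[0,\infty],\qquad \sup\emptyset:=0 .$$ Assume $s_0>0$. Then $\rho(Z)<\infty$ almost surely (so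 $F=\rho(Z)$ almost surely), $F$ is integrable, and $$\mathbb{P}(F-\mathbb{E}[F]\ge r)\le\exp\Big(\inf_{0<s<s_0}\Big(\int\phi(su)\,\nu^*(du)-sr\Big)\Big),\qquad r>0,$$ where $\exp(-\infty):=0$. -/

import Mathlib

open MeasureTheory ProbabilityTheory TopologicalSpace
open scoped ENNReal NNReal

noncomputable section

namespace BooleanModel

/-- The Fell topology on the closed subsets of `Y`, generated by the sets
`{F | F ∩ C = ∅}` (`C` compact) and `{F | F ∩ G ≠ ∅}` (`G` open). -/
@[reducible] def fellTopology (Y : Type*) [TopologicalSpace Y] : TopologicalSpace (Closeds Y) :=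
  TopologicalSpace.generateFrom
    ({U | ∃ C : Set Y, IsCompact C ∧ U = {F : Closeds Y | (F : Set Y) ∩ C = ∅}} ∪
      {U | ∃ G : Set Y, IsOpen G ∧ U = {F : Closeds Y | ((F : Set Y) ∩ G).Nonempty}})

/-- The Borel `σ`-field of the Fell topology. A set `F'` of closed sets then carries the
trace `σ`-field as a subtype. -/
instance fellMeasurableSpace (Y : Type*) [TopologicalSpace Y] : MeasurableSpace (Closeds Y) :=
  @borel (Closeds Y) (fellTopology Y)

/-- The space `𝐍(X)` of all `σ`-finite measures on `X` with values in `{0, 1, 2, …, ∞}`. -/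
def countingMeasures (X : Type*) [MeasurableSpace X] : Set (Measure X) :=
  {μ | SigmaFinite μ ∧ ∀ B, MeasurableSet B → ∃ n : ℕ∞, μ B = (n : ℝ≥0∞)}

/-- The Poisson distribution with parameter `l ∈ [0, ∞]`, as a law on `[0, ∞]`;
for `l = ∞` it is the unit mass at `∞`. -/
def poissonLaw (l : ℝ≥0∞) : Measure ℝ≥0∞ :=
  if l = ∞ then Measure.dirac ∞
  else (poissonMeasure l.toNNReal).map (fun n : ℕ => (n : ℝ≥0∞))

/-- `η` is a Poisson process on `X` with intensity measure `Λ`, defined on `(Ω, P)`. The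
`σ`-field on `Measure X` is the smallest one making all maps `μ ↦ μ B` measurable. -/
structure IsPoissonProcess {Ω X : Type*} [MeasurableSpace Ω] [MeasurableSpace X]
    (P : Measure Ω) (Λ : Measure X) (η : Ω → Measure X) : Prop where
  measurable : Measurable η
  mem_countingMeasures : ∀ ω, η ω ∈ countingMeasures X
  map_eq : ∀ B, MeasurableSet B → P.map (fun ω => η ω B) = poissonLaw (Λ B)
  indep : ∀ (m : ℕ) (B : Fin m → Set X), (∀ i, MeasurableSet (B i)) →
    Pairwise (fun i j => Disjoint (B i) (B j)) → iIndepFun (fun i ω => η ω (B i)) P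

section Particles

variable {Y : Type*} [TopologicalSpace Y] {F' : Set (Closeds Y)}

/-- The set `Z(μ)`: the union of all particles `K` of `μ` (those with `μ {K} > 0`) if
`μ (B n) < ∞` for all `n`, and the empty set otherwise. -/
def particleUnion (B : ℕ → Set F') (μ : Measure F') : Set Y :=
  {y | (∀ n, μ (B n) < ∞) ∧ ∃ K : F', 0 < μ {K} ∧ y ∈ (K : Closeds Y)}

/-- The function `f(μ) = 1{ρ(Z(μ)) < ∞} ρ(Z(μ))` (`ENNReal.toReal` sends `∞` to `0`). -/
def volumeFunctional [MeasurableSpace Y] (ρ : Measure Y) (B : ℕ → Set F') (μ : Measure F') : ℝ :=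
  (ρ (particleUnion B μ)).toReal

/-- `τ(z) = (1 - e^{-z}) / z` on `(0, ∞)`, `τ(0) = 1`, `τ(∞) = 0`. -/
def tau (z : ℝ≥0∞) : ℝ≥0∞ :=
  if z = 0 then 1
  else if z = ∞ then 0
  else ENNReal.ofReal ((1 - Real.exp (-z.toReal)) / z.toReal)

/-- `φ(z) = e^z - 1 - z`. -/
def phi (z : ℝ) : ℝ := Real.exp z - 1 - z

/-- `F'_y = {K ∈ F' : y ∈ K}`. -/
def hitting (F' : Set (Closeds Y)) (y : Y) : Set F' := {K | y ∈ (K : Closeds Y)}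

variable [MeasurableSpace Y]

/-- `ρ*(K) = ∫_K τ(Λ(F'_y)) ρ(dy)`. -/
def rhoStar (ρ : Measure Y) (Λ : Measure F') (K : F') : ℝ≥0∞ :=
  ∫⁻ y in ((K : Closeds Y) : Set Y), tau (Λ (hitting F' y)) ∂ρ

/-- `ν* = ∫ 1{ρ(K) ∈ ·} ρ*(K) / ρ(K) Λ(dK)`, a measure on `[0, ∞)`; `0 / 0 = 0` in `ℝ≥0∞`. -/
def nuStar (ρ : Measure Y) (Λ : Measure F') : Measure ℝ≥0 :=
  (Λ.withDensity (fun K => rhoStar ρ Λ K / ρ ((K : Closeds Y) : Set Y))).map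
    (fun K : F' => (ρ ((K : Closeds Y) : Set Y)).toNNReal)

/-- `s₀ = sup {s > 0 : ∫ 1{ρ(K) > 1} e^{s ρ(K)} Λ(dK) < ∞} ∈ [0, ∞]`
(`0` if there is no such `s`). -/
def sZero (ρ : Measure Y) (Λ : Measure F') : ℝ≥0∞ :=
  ⨆ s ∈ {s : ℝ≥0 | 0 < s ∧
    ∫⁻ K in {K : F' | 1 < ρ ((K : Closeds Y) : Set Y)},
      ENNReal.ofReal (Real.exp (s * (ρ ((K : Closeds Y) : Set Y)).toReal)) ∂Λ < ∞}, (s : ℝ≥0∞)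

end Particles

end BooleanModel

end

open BooleanModel

/-! The inequality is Chernoff's method applied to the bound E exp(sF) ≤ exp(s E F + ∫ φ(su)
ν*(du)), so the work lies in this exponential moment.

Suppose first that Λ is finite, and build the union in m independent steps, each adding a particle
with intensity Λ/m and adding nothing with the remaining probability. With j steps to come, adding K
to the current union L raises the expected final volume by exactly ∫_{K \ L} q^j dρ, where q(y) is
the probability that one step misses y (`iterate_step_volume_join`). This is at most g_j(K) = ∫_K
q^j dρ, whatever L is. Writing e^x = 1 + x + φ(x) inside one step and using 1 + x ≤ e^x outside
gives, by induction, an exponential bound with error exponent (1/m) ∑_j ∫ φ(s g_j) dΛ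
(`iterate_step_eexp_le`). By convexity φ(s g_j(K)) ≤ g_j(K) φ(s ρ(K)) / ρ(K), and since q(y) = 1 -
Λ(F'_y)/m, the average of the q^j is a geometric sum tending to τ(Λ(F'_y)). Thus the average of the
g_j tends to ρ*, and the exponent to ∫ φ(su) ν*(du).

A Poisson process with finite intensity has a mixed binomial law
(`IsPoissonProcess.map_eq_mixedBinomial`, by characteristic functions), so the expectation of h is
∑_k e^{-Λ(F')} A^k h(∅) / k!, where A integrates over one added particle; the m-step expectation is
(c + A/m)^m h(∅) with c = 1 - Λ(F')/m. Letting m → ∞ needs only Fatou for the exponential and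
dominated convergence for the mean and the exponent (`poissonMean_eexp_le`). For σ-finite Λ the
process is restricted to B_n and n → ∞ in the same manner (`lintegral_eexp_limitVolume_le`).

Two measurability questions need care. The measure ρ need not be σ-finite, so Tonelli does not make
ρ* measurable; it is obtained instead as a limit of differences of expected volumes, starting from
the assumed measurability of the volume. Measurability of the volume of the union in the point
process rests on the fact that finite integer-valued measures are purely atomic here. -/

namespace BooleanModel

open Filter Topology Set

/-! ### The Fell σ-field: countable generation, unions, membership, separation. -/

section Fell

variable {Y : Type*} [TopologicalSpace Y]

lemma measurableSet_miss {C : Set Y} (hC : IsCompact C) :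
    MeasurableSet {F : Closeds Y | (F : Set Y) ∩ C = ∅} :=
  MeasurableSpace.measurableSet_generateFrom
    (show IsOpen[fellTopology Y] _ from .basic _ (Or.inl ⟨C, hC, rfl⟩))

lemma measurableSet_hit {G : Set Y} (hG : IsOpen G) :
    MeasurableSet {F : Closeds Y | ((F : Set Y) ∩ G).Nonempty} :=
  MeasurableSpace.measurableSet_generateFrom
    (show IsOpen[fellTopology Y] _ from .basic _ (Or.inr ⟨G, hG, rfl⟩))

lemma measurableSet_singleton_bot : MeasurableSet ({⊥} : Set (Closeds Y)) := by
  have h : ({⊥} : Set (Closeds Y)) = {F : Closeds Y | ((F : Set Y) ∩ univ).Nonempty}ᶜ := by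
    ext F
    rw [mem_singleton_iff, mem_compl_iff, mem_ofPred_eq, inter_univ, not_nonempty_iff_eq_empty,
      ← Closeds.coe_bot, SetLike.coe_set_eq]
  rw [h]
  exact (measurableSet_hit isOpen_univ).compl

variable [SecondCountableTopology Y]

variable (Y) in
/-- A countable subbasis of the Fell topology. -/
def fellSubbasis : Set (Set (Closeds Y)) :=
  (fun U : Set Y => {F : Closeds Y | (F : Set Y) ∩ closure U = ∅}) ''
      {U ∈ countableBasis Y | IsCompact (closure U)} ∪
    (fun U : Set Y => {F : Closeds Y | ((F : Set Y) ∩ U).Nonempty}) '' countableBasis Y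

lemma countable_fellSubbasis : (fellSubbasis Y).Countable :=
  (((countable_countableBasis Y).mono (sep_subset _ _)).image _).union
    ((countable_countableBasis Y).image _)

variable [T2Space Y] [LocallyCompactSpace Y]

/-- Local compactness separates a point from a closed set by a basis set with compact closure. This
reduces every statement about the Fell topology below to countably many test sets. -/
lemma exists_countableBasis_isCompact_closure {F : Set Y} (hF : IsClosed F) {y : Y} (hy : y ∉ F) :
    ∃ U ∈ countableBasis Y, y ∈ U ∧ IsCompact (closure U) ∧ F ∩ closure U = ∅ := by
  obtain ⟨K, hK, hyK, hKF⟩ := exists_compact_subset hF.isOpen_compl hy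
  obtain ⟨U, hU, hyU, hUK⟩ := (isBasis_countableBasis Y).exists_subset_of_mem_open hyK
    isOpen_interior
  have hcl : closure U ⊆ K := closure_minimal (hUK.trans interior_subset) hK.isClosed
  refine ⟨U, hU, hyU, hK.of_isClosed_subset isClosed_closure hcl, ?_⟩
  rw [← disjoint_iff_inter_eq_empty]
  exact (disjoint_compl_right (a := F)).mono_right (hcl.trans hKF)

/-- A compact set missing F is covered by finitely many basis sets whose compact closures still miss
F, so countably many miss-conditions suffice; the hit-conditions reduce to basis sets at once. -/
lemma fellTopology_eq_generateFrom : fellTopology Y = generateFrom (fellSubbasis Y) := by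
  apply le_antisymm
  · apply le_generateFrom
    rintro _ (⟨U, ⟨-, hU⟩, rfl⟩ | ⟨U, hU, rfl⟩)
    · exact .basic _ (Or.inl ⟨_, hU, rfl⟩)
    · exact .basic _ (Or.inr ⟨_, isOpen_of_mem_countableBasis hU, rfl⟩)
  · apply le_generateFrom
    let : TopologicalSpace (Closeds Y) := generateFrom (fellSubbasis Y)
    rintro _ (⟨C, hC, rfl⟩ | ⟨G, hG, rfl⟩)
    · rw [isOpen_iff_mem_nhds]
      intro F hF
      have hy : ∀ y ∈ C, y ∉ (F : Set Y) := fun y hyC hyF =>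
        eq_empty_iff_forall_notMem.mp hF y ⟨hyF, hyC⟩
      choose! U hUb hyU hUc hUF using fun y hyC =>
        exists_countableBasis_isCompact_closure F.isClosed (hy y hyC)
      obtain ⟨t, htC, ht⟩ := hC.elim_nhds_subcover U
        fun y hyC => (isOpen_of_mem_countableBasis (hUb y hyC)).mem_nhds (hyU y hyC)
      have hmem : ⋂ y ∈ t, {F : Closeds Y | (F : Set Y) ∩ closure (U y) = ∅} ∈ 𝓝 F := by
        rw [biInter_finset_mem]
        intro y hyt
        exact (isOpen_generateFrom_of_mem (Or.inl ⟨U y, ⟨hUb y (htC y hyt), hUc y (htC y hyt)⟩,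
          rfl⟩)).mem_nhds (hUF y (htC y hyt))
      refine mem_of_superset hmem fun L hL => ?_
      rw [mem_ofPred_eq, eq_empty_iff_forall_notMem]
      rintro z ⟨hzL, hzC⟩
      obtain ⟨y, hyt, hzy⟩ := mem_iUnion₂.mp (ht hzC)
      exact eq_empty_iff_forall_notMem.mp (mem_iInter₂.mp hL y hyt) z ⟨hzL, subset_closure hzy⟩
    · rw [isOpen_iff_mem_nhds]
      rintro F ⟨y, hyF, hyG⟩
      obtain ⟨U, hU, hyU, hUG⟩ := (isBasis_countableBasis Y).exists_subset_of_mem_open hyG hG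
      have hopen : IsOpen {L : Closeds Y | ((L : Set Y) ∩ U).Nonempty} :=
        isOpen_generateFrom_of_mem (Or.inr ⟨U, hU, rfl⟩)
      exact mem_of_superset (hopen.mem_nhds ⟨y, hyF, hyU⟩)
        fun L hL => Set.Nonempty.mono (inter_subset_inter_right _ hUG) hL

/-- Countability of the subbasis is essential: only then is every open set a countable combination
of subbasic ones. Measurability of a map can then be tested on hit and miss sets. -/
lemma fellMeasurableSpace_eq :
    fellMeasurableSpace Y = MeasurableSpace.generateFrom (fellSubbasis Y) := by
  let := fellTopology Y
  have : SecondCountableTopology (Closeds Y) :=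
    ⟨⟨fellSubbasis Y, countable_fellSubbasis, fellTopology_eq_generateFrom⟩⟩
  exact borel_eq_generateFrom_of_subbasis fellTopology_eq_generateFrom

lemma measurable_closeds_of_hit_of_miss {α : Type*} [MeasurableSpace α] {f : α → Closeds Y}
    (h₁ : ∀ C : Set Y, IsCompact C → MeasurableSet {a | (f a : Set Y) ∩ C = ∅})
    (h₂ : ∀ G : Set Y, IsOpen G → MeasurableSet {a | ((f a : Set Y) ∩ G).Nonempty}) :
    Measurable f := by
  rw [fellMeasurableSpace_eq]
  apply measurable_generateFrom
  rintro _ (⟨U, ⟨-, hU⟩, rfl⟩ | ⟨U, hU, rfl⟩)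
  · exact h₁ _ hU
  · exact h₂ _ (isOpen_of_mem_countableBasis hU)

lemma measurable_closeds_sup : Measurable fun p : Closeds Y × Closeds Y => p.1 ⊔ p.2 := by
  apply measurable_closeds_of_hit_of_miss
  · intro C hC
    have h : {p : Closeds Y × Closeds Y | ((p.1 ⊔ p.2 : Closeds Y) : Set Y) ∩ C = ∅} =
        {F : Closeds Y | (F : Set Y) ∩ C = ∅} ×ˢ {F : Closeds Y | (F : Set Y) ∩ C = ∅} := by
      ext p
      simp [union_inter_distrib_right, union_empty_iff]
    rw [h]
    exact (measurableSet_miss hC).prod (measurableSet_miss hC)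
  · intro G hG
    have h : {p : Closeds Y × Closeds Y | (((p.1 ⊔ p.2 : Closeds Y) : Set Y) ∩ G).Nonempty} =
        Prod.fst ⁻¹' {F : Closeds Y | ((F : Set Y) ∩ G).Nonempty} ∪
          Prod.snd ⁻¹' {F : Closeds Y | ((F : Set Y) ∩ G).Nonempty} := by
      ext p
      simp [union_inter_distrib_right, union_nonempty]
    rw [h]
    exact (measurable_fst (measurableSet_hit hG)).union (measurable_snd (measurableSet_hit hG))

/-- The complement is a countable union of rectangles: y ∉ F exactly when some basis set contains y
and has a compact closure that misses F. -/
lemma measurableSet_mem_closeds [MeasurableSpace Y] [OpensMeasurableSpace Y] :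
    MeasurableSet {p : Y × Closeds Y | p.1 ∈ p.2} := by
  have h : {p : Y × Closeds Y | p.1 ∈ p.2}ᶜ =
      ⋃ U ∈ {U ∈ countableBasis Y | IsCompact (closure U)},
        U ×ˢ {F : Closeds Y | (F : Set Y) ∩ closure U = ∅} := by
    ext ⟨y, F⟩
    simp only [mem_compl_iff, mem_ofPred_eq, mem_iUnion, mem_prod, exists_prop]
    constructor
    · intro hy
      obtain ⟨U, hU, hyU, hUc, hUF⟩ := exists_countableBasis_isCompact_closure F.isClosed hy
      exact ⟨U, ⟨hU, hUc⟩, hyU, hUF⟩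
    · rintro ⟨U, -, hyU, hUF⟩ hyF
      exact eq_empty_iff_forall_notMem.mp hUF y ⟨hyF, subset_closure hyU⟩
  rw [← MeasurableSet.compl_iff, h]
  refine MeasurableSet.biUnion ((countable_countableBasis Y).mono (sep_subset _ _)) fun U hU => ?_
  exact (isOpen_of_mem_countableBasis hU.1).measurableSet.prod (measurableSet_miss hU.2)

instance countablySeparated_closeds : MeasurableSpace.CountablySeparated (Closeds Y) := by
  refine ⟨⟨fellSubbasis Y, countable_fellSubbasis, ?_, ?_⟩⟩
  · rintro _ (⟨U, ⟨-, hU⟩, rfl⟩ | ⟨U, hU, rfl⟩)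
    · exact measurableSet_miss hU
    · exact measurableSet_hit (isOpen_of_mem_countableBasis hU)
  · have key : ∀ F L : Closeds Y, (∀ s ∈ fellSubbasis Y, F ∈ s ↔ L ∈ s) →
        (F : Set Y) ⊆ L := by
      intro F L h y hyF
      by_contra hyL
      obtain ⟨U, hU, hyU, hUc, hUF⟩ := exists_countableBasis_isCompact_closure L.isClosed hyL
      have := (h _ (Or.inl ⟨U, ⟨hU, hUc⟩, rfl⟩)).mpr hUF
      exact eq_empty_iff_forall_notMem.mp this y ⟨hyF, subset_closure hyU⟩
    intro F _ L _ h
    exact SetLike.coe_injective ((key F L h).antisymm (key L F fun s hs => (h s hs).symm))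

end Fell

/-! ### Unions of particles as states, and the operator adding one particle. -/

section UnionModel

/-- Particles `K : X` carry sets `particle K`, states `L : D` carry finite unions of particles,
and `join` adds a particle to a state; the volume `ρ (state L)` is finite and measurable in `L`. -/
structure UnionModel (X D : Type*) {Y : Type*} [MeasurableSpace X] [MeasurableSpace D]
    [MeasurableSpace Y] (ρ : Measure Y) where
  particle : X → Set Y
  state : D → Set Y
  join : D → X → D
  empty : D
  measurable_join : Measurable fun p : D × X => join p.1 p.2
  measurableSet_particle : MeasurableSet {p : Y × X | p.1 ∈ particle p.2}
  measurableSet_state : ∀ L, MeasurableSet (state L)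
  measurable_volume : Measurable fun L => ρ (state L)
  volume_lt_top : ∀ L, ρ (state L) < ∞
  state_join : ∀ L K, state (join L K) = state L ∪ particle K
  state_empty : state empty = ∅
  join_right_comm : ∀ L K K', join (join L K) K' = join (join L K') K

/-- The model of the closed sets in `F'`, with the empty set added to the states. -/
def closedsModel {Y : Type*} [TopologicalSpace Y] [T2Space Y] [LocallyCompactSpace Y]
    [SecondCountableTopology Y] [MeasurableSpace Y] [BorelSpace Y] (ρ : Measure Y)
    (F' : Set (Closeds Y)) (hρ_fin : ∀ K ∈ F', ρ (K : Set Y) < ∞)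
    (hρ_meas : Measurable (fun K : F' => ρ ((K : Closeds Y) : Set Y)))
    (hF'_union : ∀ K ∈ F', ∀ L ∈ F', K ⊔ L ∈ F') :
    UnionModel F' {L : Closeds Y // L = ⊥ ∨ L ∈ F'} ρ where
  particle K := (K : Closeds Y)
  state L := (L : Closeds Y)
  join L K := ⟨L ⊔ K, Or.inr <| by
    obtain ⟨L, rfl | hL⟩ := L
    · rw [bot_sup_eq]; exact K.2
    · exact hF'_union _ hL _ K.2⟩
  empty := ⟨⊥, Or.inl rfl⟩
  measurable_join := (measurable_closeds_sup.comp
    ((measurable_subtype_coe.comp measurable_fst).prodMk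
      (measurable_subtype_coe.comp measurable_snd))).subtype_mk
  measurableSet_particle :=
    (measurable_fst.prodMk (measurable_subtype_coe.comp measurable_snd))
      measurableSet_mem_closeds
  measurableSet_state L := L.1.isClosed.measurableSet
  -- The empty set need not belong to `F'`, where alone measurability is assumed; it is a measurable
  -- singleton with volume 0 and is treated separately.
  measurable_volume := by
    intro s hs
    have hS : MeasurableSet {L : {L : Closeds Y // L = ⊥ ∨ L ∈ F'} | L.1 = ⊥} :=
      measurable_subtype_coe measurableSet_singleton_bot
    obtain ⟨T, hT, hTs⟩ := hρ_meas hs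
    have h : (fun L : {L : Closeds Y // L = ⊥ ∨ L ∈ F'} => ρ (L.1 : Set Y)) ⁻¹' s =
        ({L | L.1 = ⊥} ∩ {_L | (0 : ℝ≥0∞) ∈ s}) ∪ ({L | L.1 = ⊥}ᶜ ∩ Subtype.val ⁻¹' T) := by
      ext ⟨L, hL⟩
      by_cases h : L = ⊥
      · simp [h]
      · have := Set.ext_iff.mp hTs ⟨L, hL.resolve_left h⟩
        simp only [mem_preimage] at this
        simp [h, this]
    rw [h]
    exact (hS.inter (MeasurableSet.const _)).union (hS.compl.inter (measurable_subtype_coe hT))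
  volume_lt_top := by
    rintro ⟨L, rfl | hL⟩
    · simp
    · exact hρ_fin _ hL
  state_join L K := Closeds.coe_sup _ _
  state_empty := Closeds.coe_bot
  join_right_comm _ _ _ := Subtype.ext (sup_right_comm _ _ _)

namespace UnionModel

variable {X D Y : Type*} [MeasurableSpace X] [MeasurableSpace D] [MeasurableSpace Y]
  {ρ : Measure Y} (M : UnionModel X D ρ)

/-- The volume of a state. -/
def volume (L : D) : ℝ≥0∞ := ρ (M.state L)

lemma measurable_volume' : Measurable M.volume := M.measurable_volume

lemma volume_empty : M.volume M.empty = 0 := by simp [volume, M.state_empty]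

lemma volume_join_empty (K : X) : M.volume (M.join M.empty K) = ρ (M.particle K) := by
  simp [volume, M.state_join, M.state_empty]

lemma measurable_volume_particle : Measurable fun K => ρ (M.particle K) := by
  simp_rw [← M.volume_join_empty]
  exact M.measurable_volume'.comp (M.measurable_join.comp measurable_prodMk_left)

lemma volume_particle_lt_top (K : X) : ρ (M.particle K) < ∞ := by
  rw [← M.volume_join_empty]
  exact M.volume_lt_top _

lemma measurableSet_particle' (K : X) : MeasurableSet (M.particle K) :=
  measurable_prodMk_right (y := K) M.measurableSet_particle

/-- The operator that integrates over an added particle. -/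
noncomputable def addParticle (μ : Measure X) (h : D → ℝ≥0∞) (L : D) : ℝ≥0∞ :=
  ∫⁻ K, h (M.join L K) ∂μ

lemma measurable_comp_join {h : D → ℝ≥0∞} (hh : Measurable h) (L : D) :
    Measurable fun K => h (M.join L K) :=
  hh.comp (M.measurable_join.comp measurable_prodMk_left)

lemma measurable_addParticle {μ : Measure X} [SFinite μ] {h : D → ℝ≥0∞} (hh : Measurable h) :
    Measurable (M.addParticle μ h) :=
  (hh.comp M.measurable_join).lintegral_prod_right'

lemma measurable_iterate_addParticle {μ : Measure X} [SFinite μ] {h : D → ℝ≥0∞}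
    (hh : Measurable h) (j : ℕ) : Measurable ((M.addParticle μ)^[j] h) := by
  induction j with
  | zero => exact hh
  | succ j ih => rw [Function.iterate_succ_apply']; exact M.measurable_addParticle ih

/-- Here the measure varies too: joint measurability in measure and state is what makes functionals
of a random measure measurable. -/
lemma measurable_iterate_addParticle_kernel {Z : Type*} [MeasurableSpace Z] (κ : Kernel Z X)
    [IsSFiniteKernel κ] {h : D → ℝ≥0∞} (hh : Measurable h) (j : ℕ) :
    Measurable fun p : Z × D => (M.addParticle (κ p.1))^[j] h p.2 := by
  induction j with
  | zero => exact hh.comp measurable_snd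
  | succ j ih =>
    simp_rw [Function.iterate_succ_apply']
    have h1 : Measurable fun q : (Z × D) × X =>
        (M.addParticle (κ q.1.1))^[j] h (M.join q.1.2 q.2) :=
      ih.comp ((measurable_fst.comp measurable_fst).prodMk (M.measurable_join.comp
        ((measurable_snd.comp measurable_fst).prodMk measurable_snd)))
    exact h1.lintegral_kernel_prod_right' (κ := Kernel.prodMkRight D κ)

/-- The union of the particles that are atoms of `μ`. -/
def atomUnion (μ : Measure X) : Set Y := {y | ∃ K, 0 < μ {K} ∧ y ∈ M.particle K}

end UnionModel

end UnionModel

/-! ### Finite integer-valued measures are purely atomic. -/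

section Counting

variable {X : Type*} [MeasurableSpace X]

/-- Finite measures with values in `{0, 1, 2, …}`. -/
structure IsFiniteCounting (μ : Measure X) : Prop where
  finite : μ univ < ∞
  counting : ∀ B, MeasurableSet B → ∃ n : ℕ∞, μ B = (n : ℝ≥0∞)

namespace IsFiniteCounting

variable {μ : Measure X}

lemma one_le (hμ : IsFiniteCounting μ) {B : Set X} (hB : MeasurableSet B) (h : 0 < μ B) :
    1 ≤ μ B := by
  obtain ⟨n, hn⟩ := hμ.counting B hB
  rw [hn] at h ⊢
  have : n ≠ 0 := by rintro rfl; simp at h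
  exact_mod_cast Order.one_le_iff_ne_zero.mpr this

lemma zero : IsFiniteCounting (0 : Measure X) := ⟨by simp, fun _ _ => ⟨0, by simp⟩⟩

variable [MeasurableSpace.CountablySeparated X]

lemma finite_atoms (hμ : IsFiniteCounting μ) : {x | 0 < μ {x}}.Finite := by
  have := MeasurableSpace.measurableSingletonClass_of_countablySeparated (α := X)
  have h := Measure.finite_const_le_meas_of_disjoint_iUnion μ (As := fun x : X => {x}) one_pos
    (fun x => measurableSet_singleton x) (fun x y hxy => by simpa using hxy)
    ((measure_mono (subset_univ _)).trans_lt hμ.finite).ne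
  exact h.subset fun x hx => hμ.one_le (measurableSet_singleton x) hx

/-- If the non-atoms had positive mass, they could be cut successively by a separating sequence of
sets, each time keeping a piece of positive mass, hence of mass at least 1. The pieces decrease to a
set of mass at least 1 with at most one point, so that point is an atom although it was chosen among
the non-atoms. -/
lemma ae_atom (hμ : IsFiniteCounting μ) : ∀ᵐ x ∂μ, 0 < μ {x} := by
  have := MeasurableSpace.measurableSingletonClass_of_countablySeparated (α := X)
  have : IsFiniteMeasure μ := ⟨hμ.finite⟩
  obtain ⟨E, hE, hEsep⟩ := exists_seq_separating X (p := MeasurableSet) MeasurableSet.empty univ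
  have hN : MeasurableSet {x | 0 < μ {x}}ᶜ := hμ.finite_atoms.measurableSet.compl
  by_contra hne
  have hpos : 0 < μ {x | 0 < μ {x}}ᶜ := pos_iff_ne_zero.mpr hne
  have step : ∀ n, ∀ C : {C : Set X // MeasurableSet C ∧ 0 < μ C},
      ∃ C' : {C : Set X // MeasurableSet C ∧ 0 < μ C}, C'.1 ⊆ C.1 ∧
        (C'.1 ⊆ E n ∨ C'.1 ⊆ (E n)ᶜ) := by
    rintro n ⟨C, hC, hCpos⟩
    by_cases h : 0 < μ (C ∩ E n)
    · exact ⟨⟨C ∩ E n, hC.inter (hE n), h⟩, inter_subset_left, Or.inl inter_subset_right⟩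
    · refine ⟨⟨C \ E n, hC.diff (hE n), ?_⟩, sdiff_subset, Or.inr fun x hx => hx.2⟩
      have h0 : μ (C ∩ E n) = 0 := by simpa using h
      have := measure_inter_add_sdiff C (hE n) (μ := μ)
      rw [h0, zero_add] at this
      rwa [this]
  choose next hsub hdich using step
  let C : ℕ → {C : Set X // MeasurableSet C ∧ 0 < μ C} :=
    fun n => Nat.rec ⟨_, hN, hpos⟩ (fun k c => next k c) n
  have hanti : Antitone fun n => (C n).1 := antitone_nat_of_succ_le fun n => hsub n (C n)
  have hlim := tendsto_measure_iInter_atTop (μ := μ) (s := fun n => (C n).1)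
    (fun n => (C n).2.1.nullMeasurableSet) hanti ⟨0, measure_ne_top _ _⟩
  have hge : 1 ≤ μ (⋂ n, (C n).1) :=
    ge_of_tendsto' hlim fun n => hμ.one_le (C n).2.1 (C n).2.2
  obtain ⟨x, hx⟩ : (⋂ n, (C n).1).Nonempty := by
    rw [nonempty_iff_ne_empty]
    intro h
    simp [h] at hge
  have hxn := mem_iInter.mp hx
  have hsing : (⋂ n, (C n).1) = {x} := by
    refine subset_antisymm (fun y hy => ?_) (singleton_subset_iff.mpr hx)
    refine hEsep y (mem_univ _) x (mem_univ _) fun n => ?_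
    have hyn := mem_iInter.mp hy (n + 1)
    rcases hdich n (C n) with h | h
    · exact iff_of_true (h hyn) (h (hxn (n + 1)))
    · exact iff_of_false (h hyn) (h (hxn (n + 1)))
  rw [hsing] at hge
  exact hxn 0 (one_pos.trans_le hge)

end IsFiniteCounting

end Counting

/-! ### Measurability of the volume of the union of atoms. -/

namespace UnionModel

variable {X D Y : Type*} [MeasurableSpace X] [MeasurableSpace D] [MeasurableSpace Y]
  {ρ : Measure Y} (M : UnionModel X D ρ) [MeasurableSpace.CountablySeparated X]

lemma lt_volume_of_iterate_pos {μ : Measure X} (hμ : IsFiniteCounting μ) {a : ℝ≥0∞} (j : ℕ)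
    (L : D) (h : 0 < (M.addParticle μ)^[j] ({L | a < M.volume L}.indicator 1) L) :
    a < ρ (M.state L ∪ M.atomUnion μ) := by
  induction j generalizing L with
  | zero =>
    have hL : a < M.volume L := by
      by_contra hL
      simp [hL] at h
    exact hL.trans_le (measure_mono subset_union_left)
  | succ j ih =>
    rw [Function.iterate_succ_apply'] at h
    obtain ⟨K, hK, hpos⟩ : ∃ K, 0 < μ {K} ∧
        0 < (M.addParticle μ)^[j] ({L | a < M.volume L}.indicator 1) (M.join L K) := by
      by_contra! hcon
      refine h.ne' (lintegral_eq_zero_of_ae_eq_zero ?_)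
      filter_upwards [hμ.ae_atom] with K hK
      simpa using hcon K hK
    refine (ih _ hpos).trans_le (measure_mono ?_)
    rw [M.state_join, union_assoc]
    refine union_subset_union_right _ (union_subset (fun y hy => ⟨K, hK, hy⟩) subset_rfl)

lemma iterate_pos_of_lt_volume {μ : Measure X} {a : ℝ≥0∞} (l : List X)
    (hl : ∀ K ∈ l, 0 < μ {K}) (L : D) (h : a < ρ (M.state L ∪ ⋃ K ∈ l, M.particle K)) :
    0 < (M.addParticle μ)^[l.length] ({L | a < M.volume L}.indicator 1) L := by
  have := MeasurableSpace.measurableSingletonClass_of_countablySeparated (α := X)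
  induction l generalizing L with
  | nil =>
    have hL : a < M.volume L := by simpa [volume] using h
    simp [hL]
  | cons K l ih =>
    rw [List.length_cons, Function.iterate_succ_apply']
    have hpos := ih (fun K' hK' => hl K' (List.mem_cons_of_mem _ hK')) (M.join L K) (by
      simpa [M.state_join, union_assoc, Set.iUnion_or, Set.iUnion_union_distrib] using h)
    refine lt_of_lt_of_le ?_ (lintegral_mono' (Measure.restrict_le_self (s := {K})) le_rfl)
    rw [lintegral_singleton]
    exact ENNReal.mul_pos hpos.ne' (hl K List.mem_cons_self).ne'

/-- Iterated integrals against μ see only atoms, and repeated atoms do not enlarge a union. So the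
volume exceeds a exactly when some finite sequence of atoms has a union exceeding a, which the
iterated integrals of an indicator detect; these are measurable in μ. -/
lemma lt_volume_atomUnion_iff {μ : Measure X} (hμ : IsFiniteCounting μ) {a : ℝ≥0∞} :
    a < ρ (M.atomUnion μ) ↔
      ∃ j : ℕ, 0 < (M.addParticle μ)^[j] ({L | a < M.volume L}.indicator 1) M.empty := by
  constructor
  · intro h
    refine ⟨_, M.iterate_pos_of_lt_volume hμ.finite_atoms.toFinset.toList (by simp) _ ?_⟩
    have hU : ⋃ K ∈ hμ.finite_atoms.toFinset.toList, M.particle K = M.atomUnion μ := by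
      ext y
      simp [atomUnion]
    rwa [hU, M.state_empty, empty_union]
  · rintro ⟨j, hj⟩
    simpa [M.state_empty] using M.lt_volume_of_iterate_pos hμ j _ hj

/-- The volume of the union of the atoms of a finite counting measure depends measurably on the
measure. -/
lemma exists_measurable_volume_atomUnion : ∃ G : Measure X → ℝ≥0∞, Measurable G ∧
    ∀ μ, IsFiniteCounting μ → G μ = ρ (M.atomUnion μ) := by
  classical
  have hS : ∀ N : ℕ, MeasurableSet {μ : Measure X | μ univ ≤ N} := fun N =>
    measurableSet_le (Measure.measurable_coe MeasurableSet.univ) measurable_const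
  let idK : Kernel (Measure X) X := ⟨id, measurable_id⟩
  -- Truncation at total mass N turns the identity kernel into a finite kernel, as measurability of
  -- iterated integrals requires. Beyond the truncation the zero measure has no atoms and
  -- contributes nothing.
  let κ : ℕ → Kernel (Measure X) X := fun N => Kernel.piecewise (hS N) idK 0
  have hκ : ∀ N μ, κ N μ = if μ univ ≤ N then μ else 0 := fun N μ => by
    simp only [κ, Kernel.piecewise_apply]
    rfl
  have hfin : ∀ N, IsFiniteKernel (κ N) := fun N => by
    refine ⟨⟨N, by simp, fun μ => ?_⟩⟩
    rw [hκ]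
    split_ifs with h
    · exact h
    · simp
  let q : ℚ → ℝ≥0∞ := fun r => ENNReal.ofReal r
  let T : ℕ → ℕ → ℚ → Set (Measure X) := fun N j r =>
    {μ | 0 < (M.addParticle (κ N μ))^[j] ({L | q r < M.volume L}.indicator 1) M.empty}
  -- The volume is recovered as the supremum of the nonnegative rational levels below it.
  refine ⟨fun μ => ⨆ (N) (j) (r), (T N j r).indicator (fun _ => q r) μ, ?_, ?_⟩
  · refine .iSup fun N => .iSup fun j => .iSup fun r => measurable_const.indicator ?_
    refine measurableSet_lt measurable_const ((M.measurable_iterate_addParticle_kernel (κ N)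
      (measurable_const.indicator (measurableSet_lt measurable_const M.measurable_volume')) j).comp
      measurable_prodMk_right)
  · intro μ hμ
    apply le_antisymm
    · refine iSup_le fun N => iSup_le fun j => iSup_le fun r => ?_
      by_cases h : μ ∈ T N j r
      · rw [indicator_of_mem h]
        have h' : 0 < (M.addParticle (κ N μ))^[j] ({L | q r < M.volume L}.indicator 1) M.empty := h
        rw [hκ] at h'
        split_ifs at h' with hN
        · exact ((M.lt_volume_atomUnion_iff hμ).mpr ⟨j, h'⟩).le
        · have := (M.lt_volume_atomUnion_iff .zero).mpr ⟨j, h'⟩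
          simp [atomUnion] at this
      · simp [h]
    · refine le_of_forall_lt fun a ha => ?_
      obtain ⟨r, -, har, hr⟩ := ENNReal.lt_iff_exists_rat_btwn.mp ha
      obtain ⟨j, hj⟩ := (M.lt_volume_atomUnion_iff hμ).mp hr
      obtain ⟨N, hN⟩ := ENNReal.exists_nat_gt hμ.finite.ne
      refine har.trans_le (le_iSup_of_le N (le_iSup_of_le j (le_iSup_of_le r ?_)))
      have hmem : μ ∈ T N j r := by
        change 0 < (M.addParticle (κ N μ))^[j] _ _
        rw [hκ, if_pos hN.le]
        exact hj
      rw [indicator_of_mem hmem]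
      exact le_rfl

end UnionModel

/-! ### The law of a Poisson process with finite intensity. -/

section PoissonLaw

variable {Ω X : Type*} [MeasurableSpace Ω] [MeasurableSpace X] {P : Measure Ω} {Λ : Measure X}
  {η : Ω → Measure X}

namespace IsPoissonProcess

lemma measurable_apply (hη : IsPoissonProcess P Λ η) {B : Set X} (hB : MeasurableSet B) :
    Measurable fun ω => η ω B :=
  (Measure.measurable_coe hB).comp hη.measurable

lemma map_eq_of_lt_top (hη : IsPoissonProcess P Λ η) {B : Set X} (hB : MeasurableSet B)
    (hΛ : Λ B < ∞) : P.map (fun ω => η ω B) =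
      (poissonMeasure (Λ B).toNNReal).map (fun n : ℕ => (n : ℝ≥0∞)) := by
  rw [hη.map_eq B hB, poissonLaw, if_neg hΛ.ne]

lemma ae_lt_top (hη : IsPoissonProcess P Λ η) {B : Set X} (hB : MeasurableSet B)
    (hΛ : Λ B < ∞) : ∀ᵐ ω ∂P, η ω B < ∞ := by
  have hset : MeasurableSet {x : ℝ≥0∞ | x < ∞} := measurableSet_Iio
  have h := ae_map_iff (μ := P) (hη.measurable_apply hB).aemeasurable (p := fun x => x < ∞) hset
  rw [← h, hη.map_eq_of_lt_top hB hΛ, ae_map_iff (by fun_prop) hset]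
  exact .of_forall fun n => by simp

lemma map_real (hη : IsPoissonProcess P Λ η) {B : Set X} (hB : MeasurableSet B)
    (hΛ : Λ B < ∞) : P.map (fun ω => (η ω).real B) =
      (poissonMeasure (Λ B).toNNReal).map (fun n : ℕ => (n : ℝ)) := by
  have h : (fun ω => (η ω).real B) = ENNReal.toReal ∘ fun ω => η ω B := rfl
  rw [h, ← Measure.map_map ENNReal.measurable_toReal (hη.measurable_apply hB),
    hη.map_eq_of_lt_top hB hΛ, Measure.map_map ENNReal.measurable_toReal (by fun_prop)]
  congr 1

lemma restrict (hη : IsPoissonProcess P Λ η) {B : Set X} (hB : MeasurableSet B) :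
    IsPoissonProcess P (Λ.restrict B) (fun ω => (η ω).restrict B) where
  measurable := Measure.measurable_of_measurable_coe _ fun s hs => by
    simp_rw [Measure.restrict_apply hs]
    exact hη.measurable_apply (hs.inter hB)
  mem_countingMeasures ω := by
    obtain ⟨hσ, hc⟩ := hη.mem_countingMeasures ω
    refine ⟨inferInstance, fun s hs => ?_⟩
    rw [Measure.restrict_apply hs]
    exact hc _ (hs.inter hB)
  map_eq s hs := by
    simp_rw [Measure.restrict_apply hs]
    exact hη.map_eq _ (hs.inter hB)
  indep m C hC hd := by
    simp_rw [Measure.restrict_apply (hC _)]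
    exact hη.indep m _ (fun i => (hC i).inter hB)
      fun i j hij => (hd hij).mono inter_subset_left inter_subset_left

lemma iIndepFun_fiber (hη : IsPoissonProcess P Λ η) (u : SimpleFunc X ℝ) :
    iIndepFun (fun (c : u.range) ω => η ω (u ⁻¹' {(c : ℝ)})) P := by
  let e := Fintype.equivFin u.range
  have h := hη.indep _ (fun i => u ⁻¹' {(e.symm i : ℝ)}) (fun i => u.measurableSet_fiber _)
    fun i j hij => by
      refine Disjoint.preimage _ (disjoint_singleton.mpr fun h => hij ?_)
      exact e.symm.injective (Subtype.ext h)
  simpa using h.precomp e.injective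

variable [IsFiniteMeasure Λ]

/-- The fibres of u are disjoint, so the integral is a finite combination of independent Poisson
counts and its characteristic function factorizes. -/
lemma integral_exp_integral_simpleFunc (hη : IsPoissonProcess P Λ η) (u : SimpleFunc X ℝ) :
    ∫ ω, Complex.exp ((∫ x, u x ∂(η ω) : ℝ) * Complex.I) ∂P =
      Complex.exp (∫ x, (Complex.exp (u x * Complex.I) - 1) ∂Λ) := by
  have hfib := fun c : ℝ => u.measurableSet_fiber c
  have hfin := fun c : ℝ => measure_lt_top Λ (u ⁻¹' {c})
  have hmeas : ∀ c : u.range, Measurable fun ω => (c : ℝ) * (η ω).real (u ⁻¹' {(c : ℝ)}) :=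
    fun c => (hη.measurable_apply (hfib c)).ennreal_toReal.const_mul _
  have hind : iIndepFun (fun (c : u.range) ω => (c : ℝ) * (η ω).real (u ⁻¹' {(c : ℝ)})) P :=
    (hη.iIndepFun_fiber u).comp (fun c x => (c : ℝ) * x.toReal)
      fun c => ENNReal.measurable_toReal.const_mul _
  have hS : Measurable fun ω => ∑ c : u.range, (c : ℝ) * (η ω).real (u ⁻¹' {(c : ℝ)}) :=
    Finset.measurable_sum _ fun c _ => hmeas c
  calc
    ∫ ω, Complex.exp ((∫ x, u x ∂(η ω) : ℝ) * Complex.I) ∂P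
      = ∫ ω, Complex.exp ((∑ c : u.range, (c : ℝ) * (η ω).real (u ⁻¹' {(c : ℝ)}) : ℝ)
          * Complex.I) ∂P := by
        refine integral_congr_ae ?_
        filter_upwards [hη.ae_lt_top MeasurableSet.univ (measure_lt_top Λ _)] with ω hω
        have : IsFiniteMeasure (η ω) := ⟨hω⟩
        rw [SimpleFunc.integral_eq_sum _ (SimpleFunc.integrable_of_isFiniteMeasure u),
          ← Finset.sum_coe_sort]
        simp [mul_comm]
    _ = charFun (P.map fun ω => ∑ c : u.range, (c : ℝ) * (η ω).real (u ⁻¹' {(c : ℝ)})) 1 := by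
        rw [charFun_apply_real, integral_map hS.aemeasurable (by fun_prop)]
        simp
    _ = ∏ c : u.range, charFun (P.map fun ω => (c : ℝ) * (η ω).real (u ⁻¹' {(c : ℝ)})) 1 := by
        rw [hind.charFun_map_fun_sum_eq_prod fun c => (hmeas c).aemeasurable]
        simp
    _ = ∏ c : u.range, Complex.exp
          (Λ.real (u ⁻¹' {(c : ℝ)}) • (Complex.exp ((c : ℝ) * Complex.I) - 1)) := by
        refine Finset.prod_congr rfl fun c _ => ?_
        have h1 : (P.map fun ω => (c : ℝ) * (η ω).real (u ⁻¹' {(c : ℝ)})) =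
            (P.map fun ω => (η ω).real (u ⁻¹' {(c : ℝ)})).map ((c : ℝ) * ·) := by
          have h2 : Measurable fun ω => (η ω).real (u ⁻¹' {(c : ℝ)}) :=
            (hη.measurable_apply (hfib c)).ennreal_toReal
          rw [Measure.map_map (by fun_prop) h2]
          rfl
        rw [h1, charFun_map_mul, hη.map_real (hfib c) (hfin c), charFun_map_cast_poissonMeasure]
        simp [measureReal_def, ENNReal.coe_toNNReal_eq_toReal]
    _ = Complex.exp (∫ x, (Complex.exp (u x * Complex.I) - 1) ∂Λ) := by
        rw [← Complex.exp_sum]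
        congr 1
        have h2 := SimpleFunc.integrable_of_isFiniteMeasure (μ := Λ)
          (u.map fun c : ℝ => Complex.exp (c * Complex.I) - 1)
        have h3 : ∫ x, (Complex.exp (u x * Complex.I) - 1) ∂Λ =
            ∫ x, (u.map fun c : ℝ => Complex.exp (c * Complex.I) - 1) x ∂Λ := by simp
        rw [h3, ← SimpleFunc.integral_eq_integral _ h2, SimpleFunc.map_integral _ _
          (SimpleFunc.integrable_of_isFiniteMeasure u) (by simp), ← Finset.sum_coe_sort u.range]

end IsPoissonProcess

lemma measurable_sum_dirac (k : ℕ) :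
    Measurable fun x : Fin k → X => ∑ i, Measure.dirac (x i) :=
  Measure.measurable_of_measurable_coe _ fun s hs => by
    simp_rw [Measure.coe_finsetSum, Finset.sum_apply, Measure.dirac_apply' _ hs]
    exact Finset.measurable_sum _ fun i _ =>
      (measurable_one.indicator hs).comp (measurable_pi_apply i)

lemma isFiniteCounting_sum_dirac {k : ℕ} (x : Fin k → X) :
    IsFiniteCounting (∑ i, Measure.dirac (x i)) where
  finite := by simp
  counting B hB := by
    classical
    refine ⟨(((Finset.univ.filter fun i => x i ∈ B).card : ℕ) : ℕ∞), ?_⟩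
    simp [Measure.dirac_apply' _ hB, indicator_apply]

/-- The law of `δ_{x_1} + ⋯ + δ_{x_N}`, where `N` is Poisson distributed and the `x_i` are
independent with distribution proportional to `Λ`. -/
noncomputable def mixedBinomial (Λ : Measure X) : Measure (Measure X) :=
  Measure.sum fun k : ℕ => (ENNReal.ofReal (Real.exp (-Λ.real univ) / k.factorial)) •
    (Measure.pi fun _ : Fin k => Λ).map fun x => ∑ i, Measure.dirac (x i)

lemma lintegral_mixedBinomial {Λ : Measure X} {g : Measure X → ℝ≥0∞} (hg : Measurable g) :
    ∫⁻ μ, g μ ∂(mixedBinomial Λ) = ∑' k : ℕ,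
      ENNReal.ofReal (Real.exp (-Λ.real univ) / k.factorial) *
        ∫⁻ x, g (∑ i, Measure.dirac (x i)) ∂(Measure.pi fun _ : Fin k => Λ) := by
  simp_rw [mixedBinomial, lintegral_sum_measure, lintegral_smul_measure,
    lintegral_map hg (measurable_sum_dirac _), smul_eq_mul]

instance [IsFiniteMeasure Λ] : IsProbabilityMeasure (mixedBinomial Λ) := by
  constructor
  have h := lintegral_mixedBinomial (Λ := Λ) (g := fun _ => 1) measurable_one
  simp only [lintegral_one, Measure.pi_univ, Finset.prod_const, Finset.card_univ,
    Fintype.card_fin] at h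
  rw [h]
  have hs := hasSum_one_poissonMeasure (Λ univ).toNNReal
  rw [← ENNReal.ofReal_one, ← hs.tsum_eq, ENNReal.ofReal_tsum_of_nonneg (fun n => by positivity)
    hs.summable]
  refine tsum_congr fun k => ?_
  rw [← ofReal_measureReal (μ := Λ) (s := univ), ← ENNReal.ofReal_pow (by positivity),
    ← ENNReal.ofReal_mul (by positivity)]
  congr 1
  rw [ENNReal.coe_toNNReal_eq_toReal, ENNReal.toReal_ofReal (by positivity)]
  ring

lemma simpleFunc_sum_apply {ι : Type*} (s : Finset ι) (u : ι → SimpleFunc X ℝ) (x : X) :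
    (∑ i ∈ s, u i) x = ∑ i ∈ s, u i x := by
  classical
  induction s using Finset.induction_on with
  | empty => simp
  | insert i s hi ih => rw [Finset.sum_insert hi, Finset.sum_insert hi, SimpleFunc.add_apply, ih]

lemma IsPoissonProcess.integral_exp_sum (hη : IsPoissonProcess P Λ η) [IsFiniteMeasure Λ]
    {ι : Type*} [Fintype ι] {A : ι → Set X} (hA : ∀ i, MeasurableSet (A i))
    (t : ι → ℝ) :
    ∫ ω, Complex.exp ((∑ i, t i * (η ω).real (A i) : ℝ) * Complex.I) ∂P =
      Complex.exp (∫ x, (Complex.exp ((∑ i, (A i).indicator (fun _ => t i) x : ℝ)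
        * Complex.I) - 1) ∂Λ) := by
  classical
  let u : SimpleFunc X ℝ := ∑ i, SimpleFunc.piecewise (A i) (hA i) (SimpleFunc.const X (t i)) 0
  have hu : ∀ x, u x = ∑ i, (A i).indicator (fun _ => t i) x := fun x => by
    simp [u, simpleFunc_sum_apply, indicator_apply, Set.piecewise]
  simp_rw [← hu]
  rw [← hη.integral_exp_integral_simpleFunc u]
  refine integral_congr_ae ?_
  filter_upwards [hη.ae_lt_top MeasurableSet.univ (measure_lt_top Λ _)] with ω hω
  have : IsFiniteMeasure (η ω) := ⟨hω⟩
  simp_rw [hu]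
  rw [integral_finsetSum _ fun i _ => (integrable_const _).indicator (hA i)]
  simp_rw [integral_indicator (hA _)]
  simp [mul_comm]

/-- Given k points the expectation is a k-th power by independence; summing over k yields the
exponential series and the same expression as for the Poisson process. -/
lemma integral_exp_sum_mixedBinomial [IsFiniteMeasure Λ] {ι : Type*} [Fintype ι]
    {A : ι → Set X} (hA : ∀ i, MeasurableSet (A i)) (t : ι → ℝ) :
    ∫ μ, Complex.exp ((∑ i, t i * μ.real (A i) : ℝ) * Complex.I) ∂(mixedBinomial Λ) =
      Complex.exp (∫ x, (Complex.exp ((∑ i, (A i).indicator (fun _ => t i) x : ℝ)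
        * Complex.I) - 1) ∂Λ) := by
  have hm : Measurable fun μ : Measure X =>
      Complex.exp ((∑ i, t i * μ.real (A i) : ℝ) * Complex.I) := by
    have : Measurable fun μ : Measure X => ∑ i, t i * μ.real (A i) :=
      Finset.measurable_sum _ fun i _ => (Measure.measurable_coe (hA i)).ennreal_toReal.const_mul _
    fun_prop
  have hint : Integrable (fun μ : Measure X =>
      Complex.exp ((∑ i, t i * μ.real (A i) : ℝ) * Complex.I)) (mixedBinomial Λ) :=
    .of_bound hm.aestronglyMeasurable 1 (.of_forall fun μ => by
      rw [Complex.norm_exp_ofReal_mul_I])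
  set f : X → ℂ := fun x =>
    Complex.exp ((∑ i, (A i).indicator (fun _ => t i) x : ℝ) * Complex.I) with hf
  have hfm : Measurable f := by
    have : Measurable fun x => ∑ i, (A i).indicator (fun _ => t i) x :=
      Finset.measurable_sum _ fun i _ => measurable_const.indicator (hA i)
    fun_prop
  have hfint : Integrable f Λ := .of_bound hfm.aestronglyMeasurable 1 (.of_forall fun μ => by
      rw [hf, Complex.norm_exp_ofReal_mul_I])
  have hdirac : ∀ (k : ℕ) (x : Fin k → X) (i : ι),
      (∑ j, Measure.dirac (x j)).real (A i) = ∑ j, (A i).indicator (fun _ => (1 : ℝ)) (x j) := by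
    intro k x i
    rw [measureReal_def, Measure.coe_finsetSum, Finset.sum_apply, ENNReal.toReal_sum (by simp)]
    refine Finset.sum_congr rfl fun j _ => ?_
    by_cases h : x j ∈ A i <;> simp [Measure.dirac_apply' _ (hA i), h]
  have hk : ∀ k : ℕ, ∫ μ, Complex.exp ((∑ i, t i * μ.real (A i) : ℝ) * Complex.I)
      ∂(ENNReal.ofReal (Real.exp (-Λ.real univ) / k.factorial) •
        (Measure.pi fun _ : Fin k => Λ).map fun x => ∑ i, Measure.dirac (x i)) =
      Complex.exp (-Λ.real univ) * ((∫ x, f x ∂Λ) ^ k / k.factorial) := by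
    intro k
    rw [integral_smul_measure, integral_map (measurable_sum_dirac k).aemeasurable
      hm.aestronglyMeasurable, ENNReal.toReal_ofReal (by positivity)]
    have : ∀ x : Fin k → X, Complex.exp ((∑ i, t i * (∑ j, Measure.dirac (x j)).real (A i) : ℝ)
        * Complex.I) = ∏ j, f (x j) := by
      intro x
      simp_rw [hdirac, hf, ← Complex.exp_sum, ← Finset.sum_mul, ← Complex.ofReal_sum]
      congr 3
      rw [Finset.sum_comm]
      refine Finset.sum_congr rfl fun i _ => ?_
      rw [Finset.mul_sum]
      refine Finset.sum_congr rfl fun j _ => ?_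
      by_cases h : x j ∈ A i <;> simp [h]
    simp_rw [this]
    rw [integral_fintype_prod_eq_pow, Fintype.card_fin, Complex.real_smul]
    push_cast
    ring
  rw [mixedBinomial, integral_sum_measure hint]
  simp_rw [hk]
  rw [tsum_mul_left, (NormedSpace.expSeries_div_hasSum_exp (∫ x, f x ∂Λ)).tsum_eq,
    ← Complex.exp_eq_exp_ℂ, ← Complex.exp_add, integral_sub hfint (integrable_const _)]
  congr 1
  simp
  ring

/-- The distribution of a Poisson process with finite intensity measure. -/
theorem IsPoissonProcess.map_eq_mixedBinomial (hη : IsPoissonProcess P Λ η)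
    [IsProbabilityMeasure P] [IsFiniteMeasure Λ] : P.map η = mixedBinomial Λ := by
  let ev : Measure X → ({s : Set X // MeasurableSet s} → ℝ≥0∞) := fun μ s => μ s.1
  have hev : Measurable ev := measurable_pi_lambda _ fun s => Measure.measurable_coe s.2
  have : IsProbabilityMeasure (P.map η) := Measure.isProbabilityMeasure_map
    hη.measurable.aemeasurable
  -- The σ-field on measures is generated by the evaluations, so a law is determined by its image
  -- under all of them jointly.
  have hinj : (P.map η).map ev = (mixedBinomial Λ).map ev → P.map η = mixedBinomial Λ := by
    intro h
    ext S hS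
    have hle : (Measure.instMeasurableSpace : MeasurableSpace (Measure X)) ≤
        MeasurableSpace.comap ev inferInstance :=
      iSup₂_le fun s hs => by
        rw [MeasurableSpace.comap_le_iff_le_map]
        intro T hT
        exact ⟨(fun f => f ⟨s, hs⟩) ⁻¹' T, measurable_pi_apply _ hT, rfl⟩
    obtain ⟨T, hT, rfl⟩ := hle S hS
    rw [← Measure.map_apply hev hT, h, Measure.map_apply hev hT]
  refine hinj ?_
  -- Finite-dimensional laws agree because a continuous linear functional of finitely many counts is
  -- one of the sums with known characteristic function.
  have hreal : ∀ I : Finset {s : Set X // MeasurableSet s},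
      (P.map η).map (fun μ (s : I) => μ.real s.1.1) =
        (mixedBinomial Λ).map (fun μ (s : I) => μ.real s.1.1) := by
    classical
    intro I
    have hm : Measurable fun (μ : Measure X) (s : I) => μ.real s.1.1 :=
      measurable_pi_lambda _ fun s => (Measure.measurable_coe s.1.2).ennreal_toReal
    refine Measure.ext_of_charFunDual (funext fun l => ?_)
    have hl : ∀ μ : Measure X, l (fun s : I => μ.real s.1.1) =
        ∑ s : I, l (Pi.single s 1) * μ.real s.1.1 := by
      intro μ
      conv_lhs => rw [pi_eq_sum_univ' (fun s : I => μ.real s.1.1)]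
      simp only [map_sum, map_smul, smul_eq_mul]
      refine Finset.sum_congr rfl fun s _ => ?_
      rw [mul_comm]
    rw [charFunDual_apply, charFunDual_apply, integral_map hm.aemeasurable (by fun_prop),
      integral_map hm.aemeasurable (by fun_prop)]
    simp_rw [hl]
    rw [integral_exp_sum_mixedBinomial (fun s : I => s.1.2) (fun s => l (Pi.single s 1)),
      ← hη.integral_exp_sum (fun s : I => s.1.2) (fun s => l (Pi.single s 1)),
      integral_map hη.measurable.aemeasurable]
    refine Measurable.aestronglyMeasurable ?_
    have : Measurable fun μ : Measure X => ∑ s : I, l (Pi.single s 1) * μ.real s.1.1 :=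
      Finset.measurable_sum _ fun s _ =>
        (Measure.measurable_coe s.1.2).ennreal_toReal.const_mul _
    fun_prop
  have hfin : ∀ᵐ μ ∂(mixedBinomial Λ), μ univ < ∞ := by
    have hS : MeasurableSet {μ : Measure X | μ univ < ∞} :=
      measurableSet_lt (Measure.measurable_coe MeasurableSet.univ) measurable_const
    rw [mixedBinomial, Measure.ae_sum_iff' hS]
    intro k
    refine Measure.ae_smul_measure ?_ _
    rw [ae_map_iff (measurable_sum_dirac k).aemeasurable hS]
    exact .of_forall fun x => (isFiniteCounting_sum_dirac x).finite
  have hfin' : ∀ᵐ μ ∂(P.map η), μ univ < ∞ := by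
    rw [ae_map_iff hη.measurable.aemeasurable
      (measurableSet_lt (Measure.measurable_coe MeasurableSet.univ) measurable_const)]
    exact hη.ae_lt_top MeasurableSet.univ (measure_lt_top Λ _)
  -- The evaluations are extended nonnegative while characteristic functions need real values;
  -- almost sure finiteness of the total mass permits the change.
  have hproj : ∀ (Q : Measure (Measure X)), (∀ᵐ μ ∂Q, μ univ < ∞) →
      ∀ I : Finset {s : Set X // MeasurableSet s}, (Q.map ev).map I.restrict =
        (Q.map (fun μ (s : I) => μ.real s.1.1)).map fun x s => ENNReal.ofReal (x s) := by
    intro Q hQ I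
    have hm : Measurable fun (μ : Measure X) (s : I) => μ.real s.1.1 :=
      measurable_pi_lambda _ fun s => (Measure.measurable_coe s.1.2).ennreal_toReal
    rw [Measure.map_map (Finset.measurable_restrict I) hev, Measure.map_map (by fun_prop) hm]
    refine Measure.map_congr ?_
    filter_upwards [hQ] with μ hμ
    have : IsFiniteMeasure μ := ⟨hμ⟩
    ext s
    simp [ev]
  have : IsFiniteMeasure ((mixedBinomial Λ).map ev) := inferInstance
  refine IsProjectiveLimit.unique (P := fun I => ((mixedBinomial Λ).map ev).map I.restrict)
    (fun I => ?_) fun I => rfl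
  rw [hproj _ hfin', hreal, ← hproj _ hfin]

end PoissonLaw

/-! ### Expectations of the volume as a series over the number of particles. -/

section Volume

variable {Ω X D Y : Type*} [MeasurableSpace Ω] [MeasurableSpace X] [MeasurableSpace D]
  [MeasurableSpace Y] {ρ : Measure Y} (M : UnionModel X D ρ)

namespace UnionModel

/-- The state obtained by adding a tuple of particles. -/
def joinTuple : {k : ℕ} → (Fin k → X) → D → D
  | 0, _, L => L
  | _ + 1, x, L => joinTuple (Fin.tail x) (M.join L (x 0))

lemma state_joinTuple {k : ℕ} (x : Fin k → X) (L : D) :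
    M.state (M.joinTuple x L) = M.state L ∪ ⋃ i, M.particle (x i) := by
  induction k generalizing L with
  | zero => simp [joinTuple]
  | succ k ih =>
    rw [joinTuple, ih, M.state_join, union_assoc]
    congr 1
    ext y
    simp [Fin.exists_fin_succ, Fin.tail]

lemma measurable_joinTuple (k : ℕ) :
    Measurable fun p : (Fin k → X) × D => M.joinTuple p.1 p.2 := by
  induction k with
  | zero => exact measurable_snd
  | succ k ih =>
    have h : Measurable fun p : (Fin (k + 1) → X) × D => (Fin.tail p.1, M.join p.2 (p.1 0)) := by
      refine Measurable.prodMk (measurable_pi_lambda _ fun i => ?_) (M.measurable_join.comp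
        (measurable_snd.prodMk ((measurable_pi_apply 0).comp measurable_fst)))
      exact (measurable_pi_apply i.succ).comp measurable_fst
    exact ih.comp h

lemma lintegral_joinTuple {μ : Measure X} [SigmaFinite μ] {h : D → ℝ≥0∞} (hh : Measurable h)
    (k : ℕ) (L : D) : ∫⁻ x, h (M.joinTuple x L) ∂(Measure.pi fun _ : Fin k => μ) =
      (M.addParticle μ)^[k] h L := by
  induction k generalizing L with
  | zero =>
    rw [Measure.pi_of_empty _ (fun i => i.elim0)]
    simp [joinTuple]
  | succ k ih =>
    rw [Function.iterate_succ_apply', addParticle]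
    simp_rw [← ih]
    have hm : Measurable fun p : X × (Fin k → X) => h (M.joinTuple p.2 (M.join L p.1)) :=
      hh.comp ((M.measurable_joinTuple k).comp (measurable_snd.prodMk
        (M.measurable_join.comp (measurable_const.prodMk measurable_fst))))
    rw [← lintegral_prod _ hm.aemeasurable,
      ← (measurePreserving_piFinSuccAbove (fun _ => μ) 0).lintegral_comp hm]
    rfl

end UnionModel

variable {P : Measure Ω} {Λ : Measure X} {η : Ω → Measure X}

lemma atomUnion_sum_dirac [MeasurableSpace.CountablySeparated X] {k : ℕ} (x : Fin k → X) :
    M.atomUnion (∑ i, Measure.dirac (x i)) = M.state (M.joinTuple x M.empty) := by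
  have := MeasurableSpace.measurableSingletonClass_of_countablySeparated (α := X)
  rw [M.state_joinTuple, M.state_empty, empty_union]
  ext y
  simp only [UnionModel.atomUnion, Measure.coe_finsetSum, Finset.sum_apply, mem_ofPred_eq,
    mem_iUnion]
  constructor
  · rintro ⟨K, hK, hy⟩
    obtain ⟨i, -, hi⟩ := Finset.exists_ne_zero_of_sum_ne_zero hK.ne'
    have : x i = K := by
      by_contra h
      simp [h] at hi
    exact ⟨i, this ▸ hy⟩
  · rintro ⟨i, hi⟩
    refine ⟨x i, ?_, hi⟩
    refine lt_of_lt_of_le one_pos (le_trans ?_ (Finset.single_le_sum (fun j _ => zero_le)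
      (Finset.mem_univ i)))
    simp

namespace IsPoissonProcess

variable [IsFiniteMeasure Λ]

lemma ae_isFiniteCounting (hη : IsPoissonProcess P Λ η) : ∀ᵐ ω ∂P, IsFiniteCounting (η ω) := by
  filter_upwards [hη.ae_lt_top MeasurableSet.univ (measure_lt_top Λ _)] with ω hω
  exact ⟨hω, (hη.mem_countingMeasures ω).2⟩

variable [MeasurableSpace.CountablySeparated X]

lemma aemeasurable_volume (hη : IsPoissonProcess P Λ η) :
    AEMeasurable (fun ω => ρ (M.atomUnion (η ω))) P := by
  obtain ⟨G, hG, hGeq⟩ := M.exists_measurable_volume_atomUnion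
  refine ⟨G ∘ η, hG.comp hη.measurable, ?_⟩
  filter_upwards [hη.ae_isFiniteCounting] with ω hω
  exact (hGeq _ hω).symm

/-- Under the mixed binomial law, conditioning on k particles turns the expectation into k
successive integrations over an added particle. -/
theorem lintegral_volume [IsProbabilityMeasure P] (hη : IsPoissonProcess P Λ η)
    {g : ℝ≥0∞ → ℝ≥0∞} (hg : Measurable g) :
    ∫⁻ ω, g (ρ (M.atomUnion (η ω))) ∂P = ∑' k : ℕ,
      ENNReal.ofReal (Real.exp (-Λ.real univ) / k.factorial) *
        (M.addParticle Λ)^[k] (fun L => g (M.volume L)) M.empty := by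
  obtain ⟨G, hG, hGeq⟩ := M.exists_measurable_volume_atomUnion
  have h1 : ∫⁻ ω, g (ρ (M.atomUnion (η ω))) ∂P = ∫⁻ ω, g (G (η ω)) ∂P := by
    refine lintegral_congr_ae ?_
    filter_upwards [hη.ae_isFiniteCounting] with ω hω
    rw [hGeq _ hω]
  rw [h1, ← lintegral_map (f := fun μ => g (G μ)) (hg.comp hG) hη.measurable,
    hη.map_eq_mixedBinomial, lintegral_mixedBinomial (g := fun μ => g (G μ)) (hg.comp hG)]
  refine tsum_congr fun k => ?_
  rw [← M.lintegral_joinTuple (h := fun L => g (M.volume L)) (hg.comp M.measurable_volume') k]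
  congr 1
  refine lintegral_congr fun x => ?_
  rw [hGeq _ (isFiniteCounting_sum_dirac x), atomUnion_sum_dirac]
  rfl

end IsPoissonProcess

end Volume

/-! ### Exponential and φ on [0, ∞], and the convexity inequality. -/

section ExtendedExp

/-- The exponential function on `[0, ∞]`. -/
noncomputable def eexp (x : ℝ≥0∞) : ℝ≥0∞ := EReal.exp (x : EReal)

/-- The function `e^x - 1 - x` on `[0, ∞]`. -/
noncomputable def ephi (x : ℝ≥0∞) : ℝ≥0∞ := if x = ∞ then ∞ else ENNReal.ofReal (phi x.toReal)

lemma eexp_add (x y : ℝ≥0∞) : eexp (x + y) = eexp x * eexp y := by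
  simp [eexp, EReal.exp_add]

lemma eexp_mono : Monotone eexp := fun _ _ h =>
  EReal.exp_monotone (EReal.coe_ennreal_le_coe_ennreal_iff.mpr h)

lemma eexp_top : eexp ∞ = ∞ := by simp [eexp]

lemma eexp_of_ne_top {x : ℝ≥0∞} (hx : x ≠ ∞) : eexp x = ENNReal.ofReal (Real.exp x.toReal) := by
  rw [eexp, ← EReal.coe_toReal (x := (x : EReal)) (by simpa using hx) (by simp), EReal.exp_coe]
  simp

lemma measurable_eexp : Measurable eexp := eexp_mono.measurable

lemma phi_nonneg (x : ℝ) : 0 ≤ phi x := by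
  have := Real.add_one_le_exp x
  unfold phi
  linarith

lemma eexp_eq (x : ℝ≥0∞) : eexp x = 1 + (x + ephi x) := by
  by_cases hx : x = ∞
  · simp [hx, eexp_top]
  · rw [eexp_of_ne_top hx, ephi, if_neg hx]
    nth_rw 2 [← ENNReal.ofReal_toReal hx]
    rw [← ENNReal.ofReal_one, ← ENNReal.ofReal_add (by positivity) (phi_nonneg _),
      ← ENNReal.ofReal_add (by positivity) (add_nonneg (by positivity) (phi_nonneg _))]
    congr 1
    unfold phi
    ring

lemma one_add_le_eexp (x : ℝ≥0∞) : 1 + x ≤ eexp x := by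
  rw [eexp_eq]
  gcongr
  exact le_self_add

lemma ephi_zero : ephi 0 = 0 := by simp [ephi, phi]

/-- `φ(g) / g` is nondecreasing. -/
lemma phi_mul_le {t x : ℝ} (ht0 : 0 ≤ t) (ht1 : t ≤ 1) : phi (t * x) ≤ t * phi x := by
  have h := convexOn_exp.2 (mem_univ x) (mem_univ 0) ht0 (sub_nonneg.mpr ht1) (by ring)
  simp only [smul_eq_mul, mul_zero, add_zero, Real.exp_zero, mul_one] at h
  unfold phi
  linarith

lemma ephi_mono : Monotone ephi := by
  intro x y hxy
  unfold ephi
  split_ifs with hx hy hy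
  · exact le_rfl
  · exact absurd (top_le_iff.mp (hx ▸ hxy)) hy
  · exact le_top
  · apply ENNReal.ofReal_le_ofReal
    have h := ENNReal.toReal_mono hy hxy
    have hx0 : 0 ≤ x.toReal := ENNReal.toReal_nonneg
    rcases (hx0.trans h).eq_or_lt with h0 | h0
    · have : x.toReal = y.toReal := le_antisymm h (h0 ▸ hx0)
      rw [this]
    · have h1 := phi_mul_le (t := x.toReal / y.toReal) (x := y.toReal) (by positivity)
        (div_le_one_of_le₀ h h0.le)
      rw [div_mul_cancel₀ _ h0.ne'] at h1
      exact h1.trans (mul_le_of_le_one_left (phi_nonneg _) (div_le_one_of_le₀ h h0.le))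

lemma measurable_ephi : Measurable ephi := ephi_mono.measurable

/-- Convexity of φ with φ(0) = 0, written with weight g / r. Used with g a gain and r = ρ(K), it
makes the bound linear in the gain and produces the ratio ρ*/ρ in ν*. -/
lemma ephi_mul_le {s g r : ℝ≥0∞} (hs : s ≠ ∞) (hgr : g ≤ r) (hr : r ≠ ∞) :
    ephi (s * g) ≤ g * (ephi (s * r) / r) := by
  by_cases hr0 : r = 0
  · have : g = 0 := by simpa [hr0] using hgr
    simp [this, ephi_zero]
  have hg : g ≠ ∞ := ne_top_of_le_ne_top hr hgr
  rw [ephi, if_neg (ENNReal.mul_ne_top hs hg), ephi, if_neg (ENNReal.mul_ne_top hs hr),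
    ← mul_div_assoc, mul_comm g, mul_div_assoc]
  have hrpos : 0 < r.toReal := ENNReal.toReal_pos hr0 hr
  have h := phi_mul_le (t := g.toReal / r.toReal) (x := s.toReal * r.toReal) (by positivity)
    (div_le_one_of_le₀ (ENNReal.toReal_mono hr hgr) hrpos.le)
  have hgr' : g / r = ENNReal.ofReal (g.toReal / r.toReal) := by
    rw [ENNReal.ofReal_div_of_pos hrpos, ENNReal.ofReal_toReal hg, ENNReal.ofReal_toReal hr]
  rw [hgr', ← ENNReal.ofReal_mul (phi_nonneg _), ENNReal.toReal_mul, ENNReal.toReal_mul]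
  apply ENNReal.ofReal_le_ofReal
  convert h using 1
  · congr 1
    field_simp
  · ring

end ExtendedExp

/-! ### The binomial scheme and its exponential moment. -/

namespace UnionModel

variable {X D Y : Type*} [MeasurableSpace X] [MeasurableSpace D] [MeasurableSpace Y]
  {ρ : Measure Y} (M : UnionModel X D ρ)

/-- One step of the binomial approximation: with probability `c` nothing is added, and otherwise a
particle with distribution proportional to `Θ` is. -/
noncomputable def step (c : ℝ≥0∞) (Θ : Measure X) (h : D → ℝ≥0∞) (L : D) : ℝ≥0∞ :=
  c * h L + M.addParticle Θ h L

/-- The probability that `y` is not covered in one step. -/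
noncomputable def missProb (c : ℝ≥0∞) (Θ : Measure X) (y : Y) : ℝ≥0∞ :=
  c + Θ {K | y ∉ M.particle K}

/-- The expected increase of the volume by `K`, with `j` steps to come. -/
noncomputable def gain (c : ℝ≥0∞) (Θ : Measure X) (j : ℕ) (K : X) : ℝ≥0∞ :=
  ∫⁻ y in M.particle K, M.missProb c Θ y ^ j ∂ρ

variable {c : ℝ≥0∞} {Θ : Measure X}

lemma measurable_step [SFinite Θ] {h : D → ℝ≥0∞} (hh : Measurable h) :
    Measurable (M.step c Θ h) :=
  (hh.const_mul c).add (M.measurable_addParticle hh)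

lemma measurable_iterate_step [SFinite Θ] {h : D → ℝ≥0∞} (hh : Measurable h) (j : ℕ) :
    Measurable ((M.step c Θ)^[j] h) := by
  induction j with
  | zero => exact hh
  | succ j ih => rw [Function.iterate_succ_apply']; exact M.measurable_step ih

lemma measurable_missProb [SFinite Θ] : Measurable (M.missProb c Θ) :=
  measurable_const.add (measurable_measure_prodMk_left M.measurableSet_particle.compl)

lemma missProb_le_one (hc : c + Θ univ = 1) (y : Y) : M.missProb c Θ y ≤ 1 := by
  rw [← hc, missProb]
  gcongr
  exact subset_univ _

lemma step_mono {h h' : D → ℝ≥0∞} (hle : ∀ L, h L ≤ h' L) (L : D) :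
    M.step c Θ h L ≤ M.step c Θ h' L := by
  unfold step addParticle
  gcongr
  · exact hle _
  · exact hle _

/-- A point of K outside L counts as extra volume exactly when all j later steps miss it. In the
induction the new particle K' is moved in front of K; it leaves the points of K \ L outside K', and
averaging over K' supplies one more factor q. -/
lemma iterate_step_volume_join [IsFiniteMeasure Θ] (j : ℕ) (L : D) (K : X) :
    (M.step c Θ)^[j] M.volume (M.join L K) = (M.step c Θ)^[j] M.volume L +
      ∫⁻ y in M.particle K \ M.state L, M.missProb c Θ y ^ j ∂ρ := by
  have hK := M.measurableSet_particle' K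
  induction j generalizing L with
  | zero =>
    simp only [Function.iterate_zero, id_eq, pow_zero, lintegral_one, Measure.restrict_apply_univ,
      volume, M.state_join]
    rw [← union_sdiff_self, measure_union disjoint_sdiff_right (hK.diff (M.measurableSet_state L))]
  | succ j ih =>
    have hw := M.measurable_iterate_step (c := c) (Θ := Θ) M.measurable_volume' j
    have hq := M.measurable_missProb (c := c) (Θ := Θ)
    set w := (M.step c Θ)^[j] M.volume with hwdef
    set q := M.missProb c Θ with hqdef
    set S := M.particle K \ M.state L with hS
    have hSm : MeasurableSet S := hK.diff (M.measurableSet_state L)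
    -- Finite volume of the particle is what permits Tonelli, since ρ itself need not be σ-finite.
    have : IsFiniteMeasure (ρ.restrict S) := ⟨by
      rw [Measure.restrict_apply_univ]
      exact (measure_mono sdiff_subset).trans_lt (M.volume_particle_lt_top K)⟩
    simp_rw [Function.iterate_succ_apply', ← hwdef, step, addParticle]
    have h1 : ∀ K', w (M.join (M.join L K) K') = w (M.join L K') +
        ∫⁻ y in S, {y | y ∉ M.particle K'}.indicator (fun y => q y ^ j) y ∂ρ := by
      intro K'
      rw [M.join_right_comm, ih]
      congr 1
      have hm : MeasurableSet {y | y ∉ M.particle K'} := (M.measurableSet_particle' K').compl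
      rw [lintegral_indicator hm, Measure.restrict_restrict hm]
      congr 2
      ext y
      simp only [hS, M.state_join]
      grind
    simp_rw [h1]
    rw [lintegral_add_left (M.measurable_comp_join hw L), ih]
    have hpm : Measurable fun p : X × Y =>
        {y | y ∉ M.particle p.1}.indicator (fun y => q y ^ j) p.2 := by
      have : (fun p : X × Y => {y | y ∉ M.particle p.1}.indicator (fun y => q y ^ j) p.2) =
          {p : X × Y | p.2 ∉ M.particle p.1}.indicator (fun p => q p.2 ^ j) := by
        ext p
        by_cases h : p.2 ∈ M.particle p.1 <;> simp [indicator, h]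
      rw [this]
      exact ((hq.pow_const j).comp measurable_snd).indicator
        (measurable_swap M.measurableSet_particle).compl
    rw [lintegral_lintegral_swap hpm.aemeasurable]
    have h2 : ∀ y, ∫⁻ K', {y | y ∉ M.particle K'}.indicator (fun y => q y ^ j) y ∂Θ =
        Θ {K' | y ∉ M.particle K'} * q y ^ j := by
      intro y
      have hm : MeasurableSet {K' | y ∉ M.particle K'} :=
        (measurable_prodMk_left M.measurableSet_particle).compl
      have : (fun K' => {y | y ∉ M.particle K'}.indicator (fun y => q y ^ j) y) =
          {K' | y ∉ M.particle K'}.indicator fun _ => q y ^ j := by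
        ext K'
        by_cases h : y ∈ M.particle K' <;> simp [indicator, h]
      rw [this, lintegral_indicator_const hm, mul_comm]
    simp_rw [h2]
    have h3 : ∀ y, q y ^ (j + 1) = c * q y ^ j + Θ {K' | y ∉ M.particle K'} * q y ^ j := by
      intro y
      rw [pow_succ', ← add_mul]
      rfl
    simp_rw [h3]
    rw [lintegral_add_left ((hq.pow_const j).const_mul c), lintegral_const_mul _ (hq.pow_const j)]
    ring

lemma gain_le (hc : c + Θ univ = 1) (j : ℕ) (K : X) : M.gain c Θ j K ≤ ρ (M.particle K) := by
  calc M.gain c Θ j K ≤ ∫⁻ _ in M.particle K, 1 ∂ρ :=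
        lintegral_mono fun y => pow_le_one' (M.missProb_le_one hc y) j
    _ = ρ (M.particle K) := by simp

lemma lintegral_sdiff_le_gain (j : ℕ) (L : D) (K : X) :
    ∫⁻ y in M.particle K \ M.state L, M.missProb c Θ y ^ j ∂ρ ≤ M.gain c Θ j K :=
  lintegral_mono_set sdiff_subset

variable [IsFiniteMeasure Θ]

lemma iterate_step_volume_succ (hc : c + Θ univ = 1) (j : ℕ) (L : D) :
    (M.step c Θ)^[j + 1] M.volume L = (M.step c Θ)^[j] M.volume L +
      ∫⁻ K, ∫⁻ y in M.particle K \ M.state L, M.missProb c Θ y ^ j ∂ρ ∂Θ := by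
  rw [Function.iterate_succ_apply', step, addParticle]
  simp_rw [M.iterate_step_volume_join]
  rw [lintegral_add_left measurable_const, lintegral_const, ← add_assoc, mul_comm _ (Θ univ),
    ← add_mul, hc, one_mul]

lemma iterate_step_volume_le (hc : c + Θ univ = 1) (j : ℕ) (L : D) :
    (M.step c Θ)^[j] M.volume L ≤ M.volume L + j * ∫⁻ K, ρ (M.particle K) ∂Θ := by
  induction j with
  | zero => simp
  | succ j ih =>
    rw [M.iterate_step_volume_succ hc]
    calc _ ≤ (M.volume L + j * ∫⁻ K, ρ (M.particle K) ∂Θ) + ∫⁻ K, ρ (M.particle K) ∂Θ := by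
          gcongr with K
          exact (M.lintegral_sdiff_le_gain j L K).trans (M.gain_le hc j K)
      _ = _ := by push_cast; ring

/-- Without σ-finiteness of ρ, Tonelli is not available for measurability in K. The integral is
instead a difference of two expected volumes, the subtracted one being finite. -/
lemma measurable_lintegral_sdiff (hc : c + Θ univ = 1) (hΘ : ∫⁻ K, ρ (M.particle K) ∂Θ ≠ ∞)
    (j : ℕ) (L : D) :
    Measurable fun K => ∫⁻ y in M.particle K \ M.state L, M.missProb c Θ y ^ j ∂ρ := by
  have hne : (M.step c Θ)^[j] M.volume L ≠ ∞ := ne_top_of_le_ne_top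
    (ENNReal.add_ne_top.mpr ⟨(M.volume_lt_top L).ne, ENNReal.mul_ne_top (by simp) hΘ⟩)
    (M.iterate_step_volume_le hc j L)
  have h : (fun K => ∫⁻ y in M.particle K \ M.state L, M.missProb c Θ y ^ j ∂ρ) =
      fun K => (M.step c Θ)^[j] M.volume (M.join L K) - (M.step c Θ)^[j] M.volume L := by
    ext K
    rw [M.iterate_step_volume_join, ENNReal.add_sub_cancel_left hne]
  rw [h]
  exact (M.measurable_comp_join (M.measurable_iterate_step M.measurable_volume' j) L).sub_const _

lemma measurable_gain (hc : c + Θ univ = 1) (hΘ : ∫⁻ K, ρ (M.particle K) ∂Θ ≠ ∞) (j : ℕ) :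
    Measurable (M.gain c Θ j) := by
  have h := M.measurable_lintegral_sdiff hc hΘ j M.empty
  simp only [M.state_empty, sdiff_empty] at h
  exact h

/-- The exponential moment of the volume after `j` steps. -/
theorem iterate_step_eexp_le (hc : c + Θ univ = 1) (hΘ : ∫⁻ K, ρ (M.particle K) ∂Θ ≠ ∞)
    (s : ℝ≥0∞) (j : ℕ) (L : D) :
    (M.step c Θ)^[j] (fun L => eexp (s * M.volume L)) L ≤
      eexp (s * (M.step c Θ)^[j] M.volume L +
        ∑ i ∈ Finset.range j, ∫⁻ K, ephi (s * M.gain c Θ i K) ∂Θ) := by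
  induction j generalizing L with
  | zero => simp
  | succ j ih =>
    set w := (M.step c Θ)^[j] M.volume with hw
    set R := ∑ i ∈ Finset.range j, ∫⁻ K, ephi (s * M.gain c Θ i K) ∂Θ with hR
    set d : X → ℝ≥0∞ := fun K =>
      ∫⁻ y in M.particle K \ M.state L, M.missProb c Θ y ^ j ∂ρ with hd
    have hdm : Measurable d := M.measurable_lintegral_sdiff hc hΘ j L
    have hwj : ∀ K, w (M.join L K) = w L + d K := M.iterate_step_volume_join j L
    -- The linear term will be absorbed into the expected volume after one more step; only the
    -- φ-part remains as an error.
    have hint : ∫⁻ K, eexp (s * d K) ∂Θ =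
        Θ univ + (s * ∫⁻ K, d K ∂Θ + ∫⁻ K, ephi (s * d K) ∂Θ) := by
      simp_rw [eexp_eq (s * d _)]
      rw [lintegral_add_left measurable_const, lintegral_add_left (hdm.const_mul s),
        lintegral_const_mul _ hdm, lintegral_one]
    rw [Function.iterate_succ_apply', M.iterate_step_volume_succ hc, Finset.sum_range_succ, ← hw,
      ← hR]
    calc M.step c Θ ((M.step c Θ)^[j] fun L => eexp (s * M.volume L)) L
        ≤ M.step c Θ (fun L => eexp (s * w L + R)) L := M.step_mono ih L
      _ = eexp (s * w L + R) * (c + ∫⁻ K, eexp (s * d K) ∂Θ) := by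
          have hm : Measurable fun K => eexp (s * d K) := measurable_eexp.comp (hdm.const_mul s)
          rw [step, addParticle, mul_add, ← lintegral_const_mul _ hm, mul_comm c]
          congr 1
          refine lintegral_congr fun K => ?_
          rw [hwj, ← eexp_add]
          congr 1
          ring
      _ = eexp (s * w L + R) * (1 + (s * ∫⁻ K, d K ∂Θ + ∫⁻ K, ephi (s * d K) ∂Θ)) := by
          rw [hint, ← add_assoc, hc]
      -- This is 1 + x ≤ e^x, which restores the exponential form needed by the induction.
      _ ≤ eexp (s * w L + R) * eexp (s * ∫⁻ K, d K ∂Θ + ∫⁻ K, ephi (s * d K) ∂Θ) := by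
          gcongr
          exact one_add_le_eexp _
      _ = eexp (s * w L + R + (s * ∫⁻ K, d K ∂Θ + ∫⁻ K, ephi (s * d K) ∂Θ)) :=
          (eexp_add _ _).symm
      _ ≤ _ := by
          apply eexp_mono
          calc s * w L + R + (s * ∫⁻ K, d K ∂Θ + ∫⁻ K, ephi (s * d K) ∂Θ)
              = s * (w L + ∫⁻ K, d K ∂Θ) + (R + ∫⁻ K, ephi (s * d K) ∂Θ) := by ring
            _ ≤ _ := by
              gcongr with K
              exact ephi_mono (by gcongr; exact M.lintegral_sdiff_le_gain j L K)

end UnionModel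

/-! ### Poisson limits of the binomial weights and of the geometric sums. -/

section Coefficients

/-- The coefficients of the binomial approximation of a Poisson distribution with parameter `l`. -/
noncomputable def binomialCoeff (l : ℝ) (m k : ℕ) : ℝ≥0∞ :=
  m.choose k * ENNReal.ofReal (1 - l / m) ^ (m - k) * ENNReal.ofReal (1 / m) ^ k

/-- A bound free of m; up to the constant factor e^l it is the Poisson weight, so it serves as the
dominating sequence. -/
lemma binomialCoeff_le {l : ℝ} (hl : 0 ≤ l) (m k : ℕ) :
    binomialCoeff l m k ≤ ENNReal.ofReal (1 / k.factorial) := by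
  have hc : ENNReal.ofReal (1 - l / m) ≤ 1 := by
    rw [← ENNReal.ofReal_one]
    exact ENNReal.ofReal_le_ofReal (sub_le_self _ (by positivity))
  calc binomialCoeff l m k
      ≤ m.choose k * 1 * ENNReal.ofReal (1 / m) ^ k := by
        unfold binomialCoeff
        gcongr
        exact pow_le_one' hc _
    _ = ENNReal.ofReal (m.choose k * (1 / m) ^ k) := by
        rw [mul_one, ENNReal.ofReal_mul (by positivity), ENNReal.ofReal_natCast,
          ENNReal.ofReal_pow (by positivity)]
    _ ≤ ENNReal.ofReal (1 / k.factorial) := by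
        apply ENNReal.ofReal_le_ofReal
        have h1 : (m.choose k : ℝ) ≤ m ^ k / k.factorial := Nat.choose_le_pow_div k m
        have h2 : ((m : ℝ) * (1 / m)) ^ k ≤ 1 := by
          refine pow_le_one₀ (by positivity) ?_
          rw [mul_one_div]
          exact div_self_le_one _
        calc (m.choose k : ℝ) * (1 / m) ^ k ≤ m ^ k / k.factorial * (1 / m) ^ k := by gcongr
          _ = ((m : ℝ) * (1 / m)) ^ k / k.factorial := by rw [mul_pow]; ring
          _ ≤ 1 / k.factorial := by gcongr

lemma tendsto_one_sub_div_pow (l : ℝ) :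
    Tendsto (fun m : ℕ => (1 - l / m) ^ m) atTop (𝓝 (Real.exp (-l))) := by
  refine (Real.tendsto_one_add_div_pow_exp (-l)).congr fun m => ?_
  rw [neg_div, ← sub_eq_add_neg]

lemma tendsto_one_sub_div (l : ℝ) : Tendsto (fun m : ℕ => 1 - l / (m : ℝ)) atTop (𝓝 1) := by
  simpa using tendsto_const_nhds.sub (tendsto_const_div_atTop_nhds_zero_nat l)

lemma tendsto_binomialCoeff (l : ℝ) (k : ℕ) :
    Tendsto (fun m => binomialCoeff l m k) atTop
      (𝓝 (ENNReal.ofReal (Real.exp (-l) / k.factorial))) := by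
  have h1 : Tendsto (fun m : ℕ => (m.choose k : ℝ) * (1 / m) ^ k) atTop
      (𝓝 (1 ^ k / k.factorial)) := by
    refine tendsto_choose_mul_pow_atTop k (tendsto_const_nhds.congr' ?_)
    filter_upwards [eventually_gt_atTop 0] with m hm
    have : (m : ℝ) ≠ 0 := by positivity
    field_simp
  have h2 : Tendsto (fun m : ℕ => (1 - l / m) ^ (m - k)) atTop (𝓝 (Real.exp (-l))) := by
    have h3 := (tendsto_one_sub_div_pow l).div ((tendsto_one_sub_div l).pow k) (by simp)
    rw [one_pow, div_one] at h3
    refine h3.congr' ?_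
    filter_upwards [eventually_ge_atTop k,
      (tendsto_one_sub_div l).eventually_ne one_ne_zero] with m hm hne
    rw [Pi.div_apply, pow_sub₀ _ hne hm, div_eq_mul_inv]
  have h4 := ENNReal.tendsto_ofReal (h2.mul h1)
  rw [one_pow, mul_one_div] at h4
  refine h4.congr' ?_
  -- For m ≥ l the number 1 - l/m is nonnegative and `ENNReal.ofReal` does not truncate it.
  filter_upwards [eventually_gt_atTop 0, eventually_ge_atTop ⌈l⌉₊] with m hm hml
  have hpos : 0 ≤ 1 - l / m := by
    rw [sub_nonneg]
    exact div_le_one_of_le₀ ((Nat.le_ceil l).trans (by exact_mod_cast hml)) (by positivity)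
  rw [ENNReal.ofReal_mul (by positivity), ENNReal.ofReal_mul (by positivity),
    ENNReal.ofReal_pow hpos, ENNReal.ofReal_pow (by positivity), ENNReal.ofReal_natCast,
    binomialCoeff]
  ring

lemma tau_le_one (z : ℝ≥0∞) : tau z ≤ 1 := by
  unfold tau
  split_ifs with h0 h1
  · exact le_rfl
  · exact zero_le
  · rw [← ENNReal.ofReal_one]
    apply ENNReal.ofReal_le_ofReal
    have hz : 0 < z.toReal := ENNReal.toReal_pos h0 h1
    rw [div_le_one hz]
    have := Real.one_sub_le_exp_neg z.toReal
    linarith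

/-- This is the origin of τ: for z > 0 the average equals (1 - (1 - z/m)^m) / z. -/
lemma tendsto_geom_tau {z : ℝ≥0∞} (hz : z ≠ ∞) :
    Tendsto (fun m : ℕ => ENNReal.ofReal
      (1 / m * ∑ i ∈ Finset.range m, (1 - z.toReal / m) ^ i)) atTop (𝓝 (tau z)) := by
  by_cases h0 : z = 0
  · refine tendsto_const_nhds.congr' ?_
    filter_upwards [eventually_gt_atTop 0] with m hm
    have : (m : ℝ) ≠ 0 := by positivity
    simp [h0, tau, this]
  · have hpos : 0 < z.toReal := ENNReal.toReal_pos h0 hz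
    rw [tau, if_neg h0, if_neg hz]
    apply ENNReal.tendsto_ofReal
    refine ((tendsto_const_nhds.sub (tendsto_one_sub_div_pow z.toReal)).div_const _).congr' ?_
    filter_upwards [eventually_gt_atTop 0] with m hm
    have hm' : (m : ℝ) ≠ 0 := by positivity
    have h1 : (1 - z.toReal / m - 1 : ℝ) = -(z.toReal / m) := by ring
    rw [geom_sum_eq (by simp [hm', hpos.ne']), h1]
    set q : ℝ := (1 - z.toReal / m) ^ m
    field_simp
    ring

end Coefficients

/-! ### From the binomial scheme to the Poisson process. -/

namespace UnionModel

variable {X D Y : Type*} [MeasurableSpace X] [MeasurableSpace D] [MeasurableSpace Y]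
  {ρ : Measure Y} (M : UnionModel X D ρ)

/-- The binomial theorem for c + A, valid because multiplication by c commutes with the linear
operator A. -/
lemma iterate_step_eq_sum_antidiagonal {c : ℝ≥0∞} {Θ : Measure X} [SFinite Θ] {h : D → ℝ≥0∞}
    (hh : Measurable h) (m : ℕ) (L : D) :
    (M.step c Θ)^[m] h L = ∑ p ∈ Finset.HasAntidiagonal.antidiagonal m,
      (m.choose p.1 : ℝ≥0∞) * (c ^ p.2 * (M.addParticle Θ)^[p.1] h L) := by
  induction m generalizing L with
  | zero => simp
  | succ m ih =>
    have hm := fun j => M.measurable_iterate_addParticle (μ := Θ) hh j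
    rw [Finset.sum_antidiagonal_choose_succ_mul (fun i j => c ^ j * (M.addParticle Θ)^[i] h L),
      Function.iterate_succ_apply', step, ih, addParticle]
    simp_rw [ih]
    rw [lintegral_finsetSum _ fun p _ =>
        ((M.measurable_comp_join (hm _) L).const_mul _).const_mul _,
      Finset.mul_sum]
    congr 1
    · refine Finset.sum_congr rfl fun p _ => ?_
      ring
    · refine Finset.sum_congr rfl fun p hp => ?_
      rw [lintegral_const_mul _ ((M.measurable_comp_join (hm _) L).const_mul _),
        lintegral_const_mul _ (M.measurable_comp_join (hm _) L), Function.iterate_succ_apply',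
        Nat.choose_symm_of_eq_add (Finset.HasAntidiagonal.mem_antidiagonal.mp hp).symm]
      rfl

lemma iterate_addParticle_smul {Λ : Measure X} (b : ℝ≥0∞) [SFinite Λ] {h : D → ℝ≥0∞}
    (hh : Measurable h) (k : ℕ) (L : D) :
    (M.addParticle (b • Λ))^[k] h L = b ^ k * (M.addParticle Λ)^[k] h L := by
  induction k generalizing L with
  | zero => simp
  | succ k ih =>
    rw [Function.iterate_succ_apply', Function.iterate_succ_apply', addParticle,
      lintegral_smul_measure, smul_eq_mul]
    simp_rw [ih]
    rw [lintegral_const_mul _ (M.measurable_comp_join (M.measurable_iterate_addParticle hh k) L),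
      ← mul_assoc, ← pow_succ']
    rfl

/-- The expectation of `h` after `m` steps, each of which adds a particle with intensity
`Λ / m`. -/
noncomputable def binomialMean (Λ : Measure X) (m : ℕ) (h : D → ℝ≥0∞) : ℝ≥0∞ :=
  (M.step (ENNReal.ofReal (1 - Λ.real univ / m)) (ENNReal.ofReal (1 / m) • Λ))^[m] h M.empty

/-- The expectation of `h` for the union of a Poisson process of particles. -/
noncomputable def poissonMean (Λ : Measure X) (h : D → ℝ≥0∞) : ℝ≥0∞ :=
  ∑' k : ℕ, ENNReal.ofReal (Real.exp (-Λ.real univ) / k.factorial) *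
    (M.addParticle Λ)^[k] h M.empty

variable {Λ : Measure X} [IsFiniteMeasure Λ]

lemma binomialMean_eq_tsum {h : D → ℝ≥0∞} (hh : Measurable h) (m : ℕ) :
    M.binomialMean Λ m h =
      ∑' k : ℕ, binomialCoeff (Λ.real univ) m k * (M.addParticle Λ)^[k] h M.empty := by
  rw [binomialMean, M.iterate_step_eq_sum_antidiagonal hh,
    Finset.Nat.sum_antidiagonal_eq_sum_range_succ_mk, tsum_eq_sum (s := Finset.range m.succ)]
  · refine Finset.sum_congr rfl fun k _ => ?_
    rw [M.iterate_addParticle_smul _ hh, binomialCoeff]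
    ring
  · intro k hk
    have : m.choose k = 0 := Nat.choose_eq_zero_of_lt (by simpa using hk)
    simp [binomialCoeff, this]

/-- Fatou for the series over k. No finiteness is presupposed, so it applies to exponential moments
not yet known to be finite. -/
lemma poissonMean_le_liminf {h : D → ℝ≥0∞} (hh : Measurable h) :
    M.poissonMean Λ h ≤ liminf (fun m => M.binomialMean Λ m h) atTop := by
  simp_rw [M.binomialMean_eq_tsum hh, poissonMean, ← lintegral_count]
  refine le_trans (le_of_eq ?_) (lintegral_liminf_le fun m => measurable_of_countable _)
  refine lintegral_congr fun k => (Tendsto.liminf_eq ?_).symm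
  refine ENNReal.Tendsto.mul_const (tendsto_binomialCoeff _ k) (Or.inl ?_)
  simp only [ne_eq, ENNReal.ofReal_eq_zero, not_le]
  positivity

lemma tendsto_binomialMean {h : D → ℝ≥0∞} (hh : Measurable h) (hfin : M.poissonMean Λ h ≠ ∞) :
    Tendsto (fun m => M.binomialMean Λ m h) atTop (𝓝 (M.poissonMean Λ h)) := by
  have hbound : ∑' k : ℕ, ENNReal.ofReal (1 / k.factorial) * (M.addParticle Λ)^[k] h M.empty
      ≠ ∞ := by
    have : ∀ k : ℕ, ENNReal.ofReal (1 / k.factorial) * (M.addParticle Λ)^[k] h M.empty =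
        ENNReal.ofReal (Real.exp (Λ.real univ)) *
          (ENNReal.ofReal (Real.exp (-Λ.real univ) / k.factorial) *
            (M.addParticle Λ)^[k] h M.empty) := by
      intro k
      rw [← mul_assoc, ← ENNReal.ofReal_mul (by positivity), ← mul_div_assoc, ← Real.exp_add]
      simp
    simp_rw [this, ENNReal.tsum_mul_left]
    exact ENNReal.mul_ne_top ENNReal.ofReal_ne_top hfin
  simp_rw [M.binomialMean_eq_tsum hh, poissonMean]
  simp_rw [← lintegral_count] at hbound ⊢
  refine tendsto_lintegral_of_dominated_convergence _ (fun m => measurable_of_countable _)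
    (fun m => .of_forall fun k => ?_) hbound (.of_forall fun k => ?_)
  · dsimp only
    gcongr
    exact binomialCoeff_le measureReal_nonneg m k
  · refine ENNReal.Tendsto.mul_const (tendsto_binomialCoeff _ k) (Or.inl ?_)
    simp only [ne_eq, ENNReal.ofReal_eq_zero, not_le]
    positivity

lemma binomial_prob_add {m : ℕ} (hm : Λ.real univ ≤ m) :
    ENNReal.ofReal (1 - Λ.real univ / m) + (ENNReal.ofReal (1 / m) • Λ) univ = 1 := by
  rw [Measure.smul_apply, smul_eq_mul, ← ofReal_measureReal (μ := Λ) (s := univ),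
    ← ENNReal.ofReal_mul (by positivity), ← ENNReal.ofReal_add
      (sub_nonneg.mpr (div_le_one_of_le₀ hm (by positivity))) (by positivity),
    ← ENNReal.ofReal_one]
  congr 1
  ring

lemma binomialMean_volume_le {m : ℕ} (hm : Λ.real univ ≤ m) :
    M.binomialMean Λ m M.volume ≤ ∫⁻ K, ρ (M.particle K) ∂Λ := by
  have : IsFiniteMeasure (ENNReal.ofReal (1 / (m : ℝ)) • Λ) :=
    Measure.smul_finite _ ENNReal.ofReal_ne_top
  refine (M.iterate_step_volume_le (binomial_prob_add hm) m M.empty).trans ?_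
  rw [M.volume_empty, zero_add, lintegral_smul_measure, smul_eq_mul, ← mul_assoc,
    ← ENNReal.ofReal_natCast, ← ENNReal.ofReal_mul (by positivity)]
  refine mul_le_of_le_one_left' ?_
  rw [← ENNReal.ofReal_one]
  apply ENNReal.ofReal_le_ofReal
  rw [mul_one_div]
  exact div_self_le_one _

lemma poissonMean_volume_le : M.poissonMean Λ M.volume ≤ ∫⁻ K, ρ (M.particle K) ∂Λ := by
  refine (M.poissonMean_le_liminf M.measurable_volume').trans ?_
  refine liminf_le_of_le (by isBoundedDefault) fun b hb => ?_
  obtain ⟨m, hm, hm'⟩ := (hb.and (eventually_ge_atTop ⌈Λ.real univ⌉₊)).exists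
  exact hm.trans (M.binomialMean_volume_le ((Nat.le_ceil _).trans (by exact_mod_cast hm')))

/-- `ρ*(K) = ∫_K τ(Λ{K' : y ∈ K'}) ρ(dy)`. -/
noncomputable def volumeStar (Λ : Measure X) (K : X) : ℝ≥0∞ :=
  ∫⁻ y in M.particle K, tau (Λ {K' | y ∈ M.particle K'}) ∂ρ

lemma missProb_binomial {m : ℕ} (hm : Λ.real univ ≤ m) (y : Y) :
    M.missProb (ENNReal.ofReal (1 - Λ.real univ / m)) (ENNReal.ofReal (1 / m) • Λ) y =
      ENNReal.ofReal (1 - (Λ {K | y ∈ M.particle K}).toReal / m) := by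
  have hmeas : MeasurableSet {K | y ∈ M.particle K} :=
    measurable_prodMk_left M.measurableSet_particle
  have hcompl : {K | y ∉ M.particle K} = {K | y ∈ M.particle K}ᶜ := rfl
  rw [missProb, Measure.smul_apply, smul_eq_mul, hcompl,
    ← ofReal_measureReal (μ := Λ) (s := {K | y ∈ M.particle K}ᶜ),
    ← ENNReal.ofReal_mul (by positivity), ← ENNReal.ofReal_add
      (sub_nonneg.mpr (div_le_one_of_le₀ hm (by positivity))) (by positivity),
    measureReal_compl hmeas]
  congr 1
  rw [measureReal_def Λ {K | y ∈ M.particle K}]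
  ring

/-- The average of the expected gains over `m` steps. -/
noncomputable def meanGain (Λ : Measure X) (m : ℕ) (K : X) : ℝ≥0∞ :=
  ENNReal.ofReal (1 / m) * ∑ i ∈ Finset.range m, M.gain
    (ENNReal.ofReal (1 - Λ.real univ / m)) (ENNReal.ofReal (1 / m) • Λ) i K

lemma meanGain_le {m : ℕ} (hm : Λ.real univ ≤ m) (K : X) :
    M.meanGain Λ m K ≤ ρ (M.particle K) := by
  calc M.meanGain Λ m K
      ≤ ENNReal.ofReal (1 / m) * ∑ i ∈ Finset.range m, ρ (M.particle K) := by
        unfold meanGain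
        gcongr
        exact M.gain_le (binomial_prob_add hm) _ K
    _ = ENNReal.ofReal (1 / m * m) * ρ (M.particle K) := by
        rw [Finset.sum_const, Finset.card_range, nsmul_eq_mul, ENNReal.ofReal_mul (by positivity),
          ENNReal.ofReal_natCast, mul_assoc]
    _ ≤ ρ (M.particle K) := by
        refine mul_le_of_le_one_left' ?_
        rw [← ENNReal.ofReal_one]
        apply ENNReal.ofReal_le_ofReal
        rw [one_div_mul_eq_div]
        exact div_self_le_one _

lemma measurable_meanGain (hΛ : ∫⁻ K, ρ (M.particle K) ∂Λ ≠ ∞) {m : ℕ} (hm : Λ.real univ ≤ m) :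
    Measurable (M.meanGain Λ m) := by
  have : IsFiniteMeasure (ENNReal.ofReal (1 / (m : ℝ)) • Λ) :=
    Measure.smul_finite _ ENNReal.ofReal_ne_top
  refine (Finset.measurable_sum _ fun i _ =>
    M.measurable_gain (binomial_prob_add hm) ?_ i).const_mul _
  rw [lintegral_smul_measure]
  exact ENNReal.mul_ne_top ENNReal.ofReal_ne_top hΛ

/-- One step misses y with probability 1 - Λ(F'_y)/m, so averaging its powers over m steps gives the
geometric sum converging to τ; the bound 1 on a particle of finite volume dominates. -/
lemma tendsto_meanGain (K : X) :
    Tendsto (fun m => M.meanGain Λ m K) atTop (𝓝 (M.volumeStar Λ K)) := by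
  set z : Y → ℝ≥0∞ := fun y => Λ {K' | y ∈ M.particle K'} with hz
  have hzm : Measurable z := measurable_measure_prodMk_left M.measurableSet_particle
  let a : ℕ → Y → ℝ≥0∞ := fun m y => ENNReal.ofReal
    (1 / m * ∑ i ∈ Finset.range m, (1 - (z y).toReal / m) ^ i)
  have ham : ∀ m, Measurable (a m) := fun m => by
    have := hzm.ennreal_toReal
    fun_prop
  have hz1 : ∀ m : ℕ, Λ.real univ ≤ m → ∀ y, 0 ≤ 1 - (z y).toReal / m := fun m hm y =>
    sub_nonneg.mpr (div_le_one_of_le₀ ((measureReal_mono (subset_univ _)).trans hm)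
      (by positivity))
  have hev : ∀ᶠ m : ℕ in atTop, Λ.real univ ≤ m :=
    tendsto_natCast_atTop_atTop.eventually_ge_atTop _
  have heq : ∀ m : ℕ, Λ.real univ ≤ m → M.meanGain Λ m K = ∫⁻ y in M.particle K, a m y ∂ρ := by
    intro m hm
    simp only [meanGain, gain, M.missProb_binomial hm]
    have hpm : ∀ i, Measurable fun y => ENNReal.ofReal (1 - (z y).toReal / m) ^ i := fun i => by
      have := hzm.ennreal_toReal
      fun_prop
    rw [← lintegral_finsetSum _ fun i _ => hpm i, ← lintegral_const_mul _
      (Finset.measurable_sum _ fun i _ => hpm i)]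
    refine lintegral_congr fun y => ?_
    simp only [a]
    rw [ENNReal.ofReal_mul (by positivity),
      ENNReal.ofReal_sum_of_nonneg fun i _ => pow_nonneg (hz1 m hm y) i]
    simp_rw [ENNReal.ofReal_pow (hz1 m hm y)]
  have hlim : Tendsto (fun m => ∫⁻ y in M.particle K, a m y ∂ρ) atTop
      (𝓝 (M.volumeStar Λ K)) := by
    refine tendsto_lintegral_filter_of_dominated_convergence (fun _ => 1) (.of_forall ham) ?_ ?_
      (.of_forall fun y => tendsto_geom_tau (measure_ne_top Λ _))
    · filter_upwards [hev] with m hm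
      refine .of_forall fun y => ?_
      simp only [a]
      rw [← ENNReal.ofReal_one]
      apply ENNReal.ofReal_le_ofReal
      have h1 : ∑ i ∈ Finset.range m, (1 - (z y).toReal / m) ^ i ≤
          ∑ _i ∈ Finset.range m, (1 : ℝ) := Finset.sum_le_sum fun i _ =>
        pow_le_one₀ (hz1 m hm y) (sub_le_self _ (by positivity))
      calc 1 / (m : ℝ) * ∑ i ∈ Finset.range m, (1 - (z y).toReal / m) ^ i
          ≤ 1 / m * ∑ _i ∈ Finset.range m, (1 : ℝ) := by gcongr
        _ = m / m := by simp [div_eq_inv_mul]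
        _ ≤ 1 := div_self_le_one _
    · simpa using (M.volume_particle_lt_top K).ne
  refine hlim.congr' ?_
  filter_upwards [hev] with m hm
  exact (heq m hm).symm

lemma measurable_volumeStar_of_isFiniteMeasure (hΛ : ∫⁻ K, ρ (M.particle K) ∂Λ ≠ ∞) :
    Measurable (M.volumeStar Λ) := by
  obtain ⟨N, hN⟩ := exists_nat_ge (Λ.real univ)
  refine measurable_of_tendsto_metrizable (f := fun n => M.meanGain Λ (n + N)) (fun n => ?_)
    (tendsto_pi_nhds.mpr fun K => (M.tendsto_meanGain K).comp (tendsto_add_atTop_nat N))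
  exact M.measurable_meanGain hΛ (hN.trans (by push_cast; linarith [n.cast_nonneg (α := ℝ)]))

lemma volumeStar_le (Λ : Measure X) (K : X) : M.volumeStar Λ K ≤ ρ (M.particle K) := by
  calc M.volumeStar Λ K ≤ ∫⁻ _ in M.particle K, 1 ∂ρ := lintegral_mono fun y => tau_le_one _
    _ = ρ (M.particle K) := by simp

lemma mul_ephi_div_le {s g r : ℝ≥0∞} (h : g ≤ r) :
    g * (ephi (s * r) / r) ≤ ephi (s * r) := by
  calc g * (ephi (s * r) / r) ≤ r * (ephi (s * r) / r) := by gcongr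
    _ ≤ ephi (s * r) := ENNReal.mul_div_le

/-- Once convexity has made each φ-term linear in its gain, the sum over the steps collapses to the
mean gain. -/
lemma binomialMean_eexp_le (hΛ : ∫⁻ K, ρ (M.particle K) ∂Λ ≠ ∞) {s : ℝ≥0∞} (hs : s ≠ ∞) {m : ℕ}
    (hm : Λ.real univ ≤ m) :
    M.binomialMean Λ m (fun L => eexp (s * M.volume L)) ≤
      eexp (s * M.binomialMean Λ m M.volume +
        ∫⁻ K, M.meanGain Λ m K * (ephi (s * ρ (M.particle K)) / ρ (M.particle K)) ∂Λ) := by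
  have : IsFiniteMeasure (ENNReal.ofReal (1 / (m : ℝ)) • Λ) :=
    Measure.smul_finite _ ENNReal.ofReal_ne_top
  have hc := binomial_prob_add hm
  have hΘ : ∫⁻ K, ρ (M.particle K) ∂(ENNReal.ofReal (1 / (m : ℝ)) • Λ) ≠ ∞ := by
    rw [lintegral_smul_measure]
    exact ENNReal.mul_ne_top ENNReal.ofReal_ne_top hΛ
  refine (M.iterate_step_eexp_le hc hΘ s m M.empty).trans (eexp_mono ?_)
  gcongr
  · exact le_rfl
  have hg := fun i => M.measurable_gain hc hΘ i
  have hr : Measurable fun K => ephi (s * ρ (M.particle K)) / ρ (M.particle K) :=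
    (measurable_ephi.comp (M.measurable_volume_particle.const_mul s)).div
      M.measurable_volume_particle
  simp_rw [lintegral_smul_measure, smul_eq_mul, ← Finset.mul_sum]
  calc _ ≤ ENNReal.ofReal (1 / m) * ∑ i ∈ Finset.range m, ∫⁻ K, M.gain
          (ENNReal.ofReal (1 - Λ.real univ / m)) (ENNReal.ofReal (1 / m) • Λ) i K *
            (ephi (s * ρ (M.particle K)) / ρ (M.particle K)) ∂Λ := by
        gcongr with i _ K
        exact ephi_mul_le hs (M.gain_le hc i K) (M.volume_particle_lt_top K).ne
    _ = _ := by
        have hgr : ∀ i, Measurable fun K => M.gain (ENNReal.ofReal (1 - Λ.real univ / m))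
            (ENNReal.ofReal (1 / m) • Λ) i K *
              (ephi (s * ρ (M.particle K)) / ρ (M.particle K)) := fun i => (hg i).mul hr
        rw [← lintegral_finsetSum _ fun i _ => hgr i,
          ← lintegral_const_mul _ (Finset.measurable_sum _ fun i _ => hgr i)]
        refine lintegral_congr fun K => ?_
        rw [meanGain, mul_assoc, Finset.sum_mul]

lemma continuous_eexp : Continuous eexp :=
  ENNReal.continuous_exp.comp continuous_coe_ennreal_ereal

theorem poissonMean_eexp_le (hΛ : ∫⁻ K, ρ (M.particle K) ∂Λ ≠ ∞) {s : ℝ≥0∞} (hs : s ≠ ∞)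
    (hφ : ∫⁻ K, ephi (s * ρ (M.particle K)) ∂Λ ≠ ∞) :
    M.poissonMean Λ (fun L => eexp (s * M.volume L)) ≤
      eexp (s * M.poissonMean Λ M.volume +
        ∫⁻ K, M.volumeStar Λ K * (ephi (s * ρ (M.particle K)) / ρ (M.particle K)) ∂Λ) := by
  have hev : ∀ᶠ m : ℕ in atTop, Λ.real univ ≤ m :=
    tendsto_natCast_atTop_atTop.eventually_ge_atTop _
  have hr : Measurable fun K => ephi (s * ρ (M.particle K)) / ρ (M.particle K) :=
    (measurable_ephi.comp (M.measurable_volume_particle.const_mul s)).div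
      M.measurable_volume_particle
  have hv := M.tendsto_binomialMean (Λ := Λ) M.measurable_volume'
    (ne_top_of_le_ne_top hΛ M.poissonMean_volume_le)
  have hlim : Tendsto (fun m => ∫⁻ K, M.meanGain Λ m K *
      (ephi (s * ρ (M.particle K)) / ρ (M.particle K)) ∂Λ) atTop (𝓝 (∫⁻ K, M.volumeStar Λ K *
        (ephi (s * ρ (M.particle K)) / ρ (M.particle K)) ∂Λ)) := by
    refine tendsto_lintegral_filter_of_dominated_convergence
      (fun K => ephi (s * ρ (M.particle K))) ?_ ?_ hφ (.of_forall fun K => ?_)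
    · filter_upwards [hev] with m hm
      exact (M.measurable_meanGain hΛ hm).mul hr
    · filter_upwards [hev] with m hm
      exact .of_forall fun K => mul_ephi_div_le (M.meanGain_le hm K)
    -- Particles of zero volume contribute nothing, because 0 / 0 = 0.
    · by_cases h0 : ρ (M.particle K) = 0
      · simp [h0, ephi_zero]
      · refine ENNReal.Tendsto.mul_const (M.tendsto_meanGain K) (Or.inr ?_)
        refine ENNReal.div_ne_top ?_ h0
        rw [ephi, if_neg (ENNReal.mul_ne_top hs (M.volume_particle_lt_top K).ne)]
        exact ENNReal.ofReal_ne_top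
  have hexp := (continuous_eexp.tendsto _).comp
    ((ENNReal.Tendsto.const_mul hv (Or.inr hs)).add hlim)
  refine (M.poissonMean_le_liminf (measurable_eexp.comp
    (M.measurable_volume'.const_mul s))).trans ?_
  rw [← hexp.liminf_eq]
  refine liminf_le_liminf ?_
  filter_upwards [hev] with m hm
  exact M.binomialMean_eexp_le hΛ hs hm

end UnionModel

/-! ### Continuity of τ on [0, ∞]. -/

section Tau

lemma tau_le_inv (z : ℝ≥0∞) : tau z ≤ z⁻¹ := by
  unfold tau
  split_ifs with h0 h1
  · simp [h0]
  · exact zero_le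
  · have hz : 0 < z.toReal := ENNReal.toReal_pos h0 h1
    rw [← ENNReal.ofReal_toReal h1, ← ENNReal.ofReal_inv_of_pos hz, ENNReal.ofReal_toReal h1,
      ← one_div]
    apply ENNReal.ofReal_le_ofReal
    gcongr
    linarith [Real.exp_pos (-z.toReal)]

lemma exp_neg_le_tau {z : ℝ≥0∞} (hz : z ≠ ∞) : ENNReal.ofReal (Real.exp (-z.toReal)) ≤ tau z := by
  unfold tau
  split_ifs with h0
  · simp [h0]
  · have hz : 0 < z.toReal := ENNReal.toReal_pos h0 hz
    apply ENNReal.ofReal_le_ofReal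
    rw [le_div_iff₀ hz]
    have h1 := Real.add_one_le_exp z.toReal
    have h2 : Real.exp (-z.toReal) * Real.exp z.toReal = 1 := by rw [← Real.exp_add]; simp
    nlinarith [Real.exp_pos (-z.toReal)]

/-- The endpoints need squeezing: 1/z from above at ∞, and e^{-z} from below at 0. Continuity at ∞
is needed because Λ(F'_y) may be infinite. -/
lemma continuous_tau : Continuous tau := by
  rw [continuous_iff_continuousAt]
  intro z
  by_cases h1 : z = ∞
  · subst h1
    have ht : tau ∞ = 0 := by simp [tau]
    rw [ContinuousAt, ht]
    refine tendsto_of_tendsto_of_tendsto_of_le_of_le tendsto_const_nhds ?_ (fun _ => zero_le)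
      tau_le_inv
    simpa using (continuous_inv.tendsto (∞ : ℝ≥0∞))
  have hlt : ∀ᶠ x in 𝓝 z, x ≠ ∞ := isOpen_ne.mem_nhds h1
  have hreal : Tendsto ENNReal.toReal (𝓝 z) (𝓝 z.toReal) := ENNReal.tendsto_toReal h1
  by_cases h0 : z = 0
  · subst h0
    have ht : tau 0 = 1 := by simp [tau]
    rw [ContinuousAt, ht]
    have hlow : Tendsto (fun x : ℝ≥0∞ => ENNReal.ofReal (Real.exp (-x.toReal))) (𝓝 0) (𝓝 1) := by
      have := ENNReal.tendsto_ofReal ((Real.continuous_exp.tendsto _).comp hreal.neg)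
      simpa using this
    refine tendsto_of_tendsto_of_tendsto_of_le_of_le' hlow tendsto_const_nhds ?_
      (.of_forall tau_le_one)
    filter_upwards [hlt] with x hx
    exact exp_neg_le_tau hx
  · have hne : ∀ᶠ x in 𝓝 z, x ≠ 0 := isOpen_ne.mem_nhds h0
    rw [ContinuousAt, show tau z = _ from by rw [tau, if_neg h0, if_neg h1]]
    have hnum : Tendsto (fun x : ℝ≥0∞ => 1 - Real.exp (-x.toReal)) (𝓝 z)
        (𝓝 (1 - Real.exp (-z.toReal))) :=
      tendsto_const_nhds.sub ((Real.continuous_exp.tendsto _).comp hreal.neg)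
    refine (ENNReal.tendsto_ofReal (hnum.div hreal (ENNReal.toReal_pos h0 h1).ne')).congr' ?_
    filter_upwards [hlt, hne] with x hx hx0
    rw [tau, if_neg hx0, if_neg hx]
    rfl

end Tau

/-! ### Exhaustion: from finite to σ-finite intensity. -/

namespace UnionModel

variable {Ω X D Y : Type*} [MeasurableSpace Ω] [MeasurableSpace X] [MeasurableSpace D]
  [MeasurableSpace Y] {ρ : Measure Y} (M : UnionModel X D ρ) {Λ : Measure X} {B : ℕ → Set X}

lemma tendsto_volumeStar_restrict (hB_mono : Monotone B) (hB_univ : ⋃ n, B n = univ)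
    (hB_fin : ∀ n, Λ (B n) < ∞) (K : X) :
    Tendsto (fun n => M.volumeStar (Λ.restrict (B n)) K) atTop (𝓝 (M.volumeStar Λ K)) := by
  have hmeas : ∀ y, MeasurableSet {K' | y ∈ M.particle K'} := fun y =>
    measurable_prodMk_left M.measurableSet_particle
  refine tendsto_lintegral_of_dominated_convergence (fun _ => 1) (fun n => ?_)
    (fun n => .of_forall fun y => tau_le_one _) ?_ (.of_forall fun y => ?_)
  · have : IsFiniteMeasure (Λ.restrict (B n)) := ⟨by simpa using hB_fin n⟩
    exact continuous_tau.measurable.comp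
      (measurable_measure_prodMk_left M.measurableSet_particle)
  · simpa using (M.volume_particle_lt_top K).ne
  · refine (continuous_tau.tendsto _).comp ?_
    simp_rw [Measure.restrict_apply (hmeas y)]
    have h := tendsto_measure_iUnion_atTop (μ := Λ) (s := fun n => {K' | y ∈ M.particle K'} ∩ B n)
      fun m n hmn => inter_subset_inter_right _ (hB_mono hmn)
    rwa [← inter_iUnion, hB_univ, inter_univ] at h

lemma measurable_volumeStar (hB_mono : Monotone B) (hB_univ : ⋃ n, B n = univ)
    (hB_fin : ∀ n, Λ (B n) < ∞) (hΛ : ∫⁻ K, ρ (M.particle K) ∂Λ ≠ ∞) :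
    Measurable (M.volumeStar Λ) := by
  refine measurable_of_tendsto_metrizable (fun n => ?_)
    (tendsto_pi_nhds.mpr fun K => M.tendsto_volumeStar_restrict hB_mono hB_univ hB_fin K)
  have : IsFiniteMeasure (Λ.restrict (B n)) := ⟨by simpa using hB_fin n⟩
  exact M.measurable_volumeStar_of_isFiniteMeasure
    (ne_top_of_le_ne_top hΛ (lintegral_mono' Measure.restrict_le_self le_rfl))

lemma atomUnion_mono {μ ν : Measure X} (h : μ ≤ ν) : M.atomUnion μ ⊆ M.atomUnion ν := by
  rintro y ⟨K, hK, hy⟩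
  exact ⟨K, hK.trans_le (h _), hy⟩

/-- The volume of the union of all particles in some `B n`. -/
noncomputable def limitVolume (B : ℕ → Set X) (μ : Measure X) : ℝ≥0∞ :=
  ⨆ n, ρ (M.atomUnion (μ.restrict (B n)))

lemma monotone_volume_atomUnion (hB_mono : Monotone B) (μ : Measure X) :
    Monotone fun n => ρ (M.atomUnion (μ.restrict (B n))) := fun _ _ hmn =>
  measure_mono (M.atomUnion_mono (Measure.restrict_mono (hB_mono hmn) le_rfl))

variable {P : Measure Ω} {η : Ω → Measure X} [MeasurableSpace.CountablySeparated X]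

lemma aemeasurable_limitVolume (hη : IsPoissonProcess P Λ η) (hB_meas : ∀ n, MeasurableSet (B n))
    (hB_fin : ∀ n, Λ (B n) < ∞) : AEMeasurable (fun ω => M.limitVolume B (η ω)) P := by
  refine .iSup fun n => ?_
  have : IsFiniteMeasure (Λ.restrict (B n)) := ⟨by simpa using hB_fin n⟩
  exact (hη.restrict (hB_meas n)).aemeasurable_volume M

variable [IsProbabilityMeasure P]

lemma lintegral_limitVolume_le (hη : IsPoissonProcess P Λ η)
    (hB_meas : ∀ n, MeasurableSet (B n)) (hB_mono : Monotone B) (hB_fin : ∀ n, Λ (B n) < ∞) :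
    ∫⁻ ω, M.limitVolume B (η ω) ∂P ≤ ∫⁻ K, ρ (M.particle K) ∂Λ := by
  have hfin : ∀ n, IsFiniteMeasure (Λ.restrict (B n)) := fun n => ⟨by simpa using hB_fin n⟩
  simp_rw [limitVolume]
  rw [lintegral_iSup' (fun n => (hη.restrict (hB_meas n)).aemeasurable_volume M)
    (.of_forall fun ω => M.monotone_volume_atomUnion hB_mono (η ω))]
  refine iSup_le fun n => ?_
  rw [(hη.restrict (hB_meas n)).lintegral_volume M (g := fun x => x) measurable_id]
  exact M.poissonMean_volume_le.trans (lintegral_mono' Measure.restrict_le_self le_rfl)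

theorem lintegral_eexp_limitVolume_le (hη : IsPoissonProcess P Λ η)
    (hB_meas : ∀ n, MeasurableSet (B n)) (hB_mono : Monotone B) (hB_univ : ⋃ n, B n = univ)
    (hB_fin : ∀ n, Λ (B n) < ∞) (hΛ : ∫⁻ K, ρ (M.particle K) ∂Λ ≠ ∞) {s : ℝ≥0∞} (hs : s ≠ ∞)
    (hφ : ∫⁻ K, ephi (s * ρ (M.particle K)) ∂Λ ≠ ∞) :
    ∫⁻ ω, eexp (s * M.limitVolume B (η ω)) ∂P ≤
      eexp (s * ∫⁻ ω, M.limitVolume B (η ω) ∂P +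
        ∫⁻ K, M.volumeStar Λ K * (ephi (s * ρ (M.particle K)) / ρ (M.particle K)) ∂Λ) := by
  have hfin : ∀ n, IsFiniteMeasure (Λ.restrict (B n)) := fun n => ⟨by simpa using hB_fin n⟩
  have hΛn : ∀ n, ∫⁻ K, ρ (M.particle K) ∂(Λ.restrict (B n)) ≠ ∞ := fun n =>
    ne_top_of_le_ne_top hΛ (lintegral_mono' Measure.restrict_le_self le_rfl)
  have hφn : ∀ n, ∫⁻ K, ephi (s * ρ (M.particle K)) ∂(Λ.restrict (B n)) ≠ ∞ := fun n =>
    ne_top_of_le_ne_top hφ (lintegral_mono' Measure.restrict_le_self le_rfl)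
  have hr : Measurable fun K => ephi (s * ρ (M.particle K)) / ρ (M.particle K) :=
    (measurable_ephi.comp (M.measurable_volume_particle.const_mul s)).div
      M.measurable_volume_particle
  -- As τ is decreasing, these integrands decrease in n, so an integrable majorant is required; φ(s
  -- ρ(K)) provides it.
  have hlim : Tendsto (fun n => ∫⁻ K, M.volumeStar (Λ.restrict (B n)) K *
      (ephi (s * ρ (M.particle K)) / ρ (M.particle K)) ∂Λ) atTop (𝓝 (∫⁻ K, M.volumeStar Λ K *
        (ephi (s * ρ (M.particle K)) / ρ (M.particle K)) ∂Λ)) := by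
    refine tendsto_lintegral_of_dominated_convergence (fun K => ephi (s * ρ (M.particle K)))
      (fun n => (M.measurable_volumeStar_of_isFiniteMeasure (hΛn n)).mul hr)
      (fun n => .of_forall fun K => mul_ephi_div_le (M.volumeStar_le _ K)) hφ
      (.of_forall fun K => ?_)
    by_cases h0 : ρ (M.particle K) = 0
    · simp [h0, ephi_zero]
    · refine ENNReal.Tendsto.mul_const
        (M.tendsto_volumeStar_restrict hB_mono hB_univ hB_fin K) (Or.inr ?_)
      refine ENNReal.div_ne_top ?_ h0
      rw [ephi, if_neg (ENNReal.mul_ne_top hs (M.volume_particle_lt_top K).ne)]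
      exact ENNReal.ofReal_ne_top
  -- The mean of the restricted volume is replaced by the full mean, and the outer integral is
  -- extended to all of Λ, so that only the factor `volumeStar` still depends on n.
  have hn : ∀ n, ∫⁻ ω, eexp (s * ρ (M.atomUnion ((η ω).restrict (B n)))) ∂P ≤
      eexp (s * ∫⁻ ω, M.limitVolume B (η ω) ∂P + ∫⁻ K, M.volumeStar (Λ.restrict (B n)) K *
        (ephi (s * ρ (M.particle K)) / ρ (M.particle K)) ∂Λ) := by
    intro n
    have hηn := hη.restrict (hB_meas n)
    rw [hηn.lintegral_volume M (g := fun x => eexp (s * x))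
      (measurable_eexp.comp (measurable_id.const_mul s))]
    refine (M.poissonMean_eexp_le (hΛn n) hs (hφn n)).trans (eexp_mono ?_)
    have hmean : M.poissonMean (Λ.restrict (B n)) M.volume =
        ∫⁻ ω, ρ (M.atomUnion ((η ω).restrict (B n))) ∂P :=
      (hηn.lintegral_volume M (g := fun x => x) measurable_id).symm
    rw [hmean]
    refine add_le_add ?_ (lintegral_mono' Measure.restrict_le_self le_rfl)
    gcongr with ω
    exact le_iSup (fun n => ρ (M.atomUnion ((η ω).restrict (B n)))) n
  have hω : ∀ ω, Tendsto (fun n => eexp (s * ρ (M.atomUnion ((η ω).restrict (B n))))) atTop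
      (𝓝 (eexp (s * M.limitVolume B (η ω)))) := fun ω =>
    (continuous_eexp.tendsto _).comp (ENNReal.Tendsto.const_mul
      (tendsto_atTop_iSup (M.monotone_volume_atomUnion hB_mono (η ω))) (Or.inr hs))
  have hexp := (continuous_eexp.tendsto _).comp (hlim.const_add
    (s * ∫⁻ ω, M.limitVolume B (η ω) ∂P))
  calc ∫⁻ ω, eexp (s * M.limitVolume B (η ω)) ∂P
      = ∫⁻ ω, liminf (fun n => eexp (s * ρ (M.atomUnion ((η ω).restrict (B n))))) atTop ∂P :=
        lintegral_congr fun ω => (hω ω).liminf_eq.symm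
    _ ≤ liminf (fun n => ∫⁻ ω, eexp (s * ρ (M.atomUnion ((η ω).restrict (B n)))) ∂P) atTop :=
        lintegral_liminf_le' fun n => measurable_eexp.comp_aemeasurable
          (((hη.restrict (hB_meas n)).aemeasurable_volume M).const_mul s)
    _ ≤ _ := by
        rw [← hexp.liminf_eq]
        exact liminf_le_liminf (.of_forall hn)

end UnionModel

/-- Markov's inequality for the exponential moment. -/
lemma measure_le_of_lintegral_eexp_le {Ω : Type*} [MeasurableSpace Ω] {P : Measure Ω}
    {V : Ω → ℝ≥0∞} (hV : AEMeasurable V P) {e I : ℝ≥0∞} (he : e ≠ ∞) {s r : ℝ} (hs : 0 ≤ s)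
    (hr : 0 ≤ r) (h : ∫⁻ ω, eexp (ENNReal.ofReal s * V ω) ∂P ≤ eexp (ENNReal.ofReal s * e + I)) :
    P {ω | e + ENNReal.ofReal r ≤ V ω} ≤ EReal.exp ((I : EReal) - ((s * r : ℝ) : EReal)) := by
  have hs' : ENNReal.ofReal s ≠ ∞ := ENNReal.ofReal_ne_top
  have hle : P {ω | e + ENNReal.ofReal r ≤ V ω} *
      eexp (ENNReal.ofReal s * (e + ENNReal.ofReal r)) ≤ eexp (ENNReal.ofReal s * e + I) := by
    refine le_trans ?_ h
    rw [mul_comm]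
    refine le_trans ?_ (mul_meas_ge_le_lintegral₀
      (measurable_eexp.comp_aemeasurable (hV.const_mul (ENNReal.ofReal s)))
      (eexp (ENNReal.ofReal s * (e + ENNReal.ofReal r))))
    exact mul_le_mul_right (measure_mono fun ω hω => eexp_mono (mul_le_mul_right hω _)) _
  have hne : eexp (ENNReal.ofReal s * e) ≠ ∞ := by
    rw [eexp_of_ne_top (ENNReal.mul_ne_top hs' he)]
    exact ENNReal.ofReal_ne_top
  have hne0 : eexp (ENNReal.ofReal s * e) ≠ 0 :=
    (one_pos.trans_le (le_self_add.trans (one_add_le_eexp _))).ne'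
  -- The factor exp(s e) is finite and nonzero, so it cancels; I may be infinite.
  rw [mul_add, eexp_add, eexp_add, mul_left_comm, ENNReal.mul_le_mul_iff_right hne0 hne] at hle
  have hsr : eexp (ENNReal.ofReal s * ENNReal.ofReal r) = EReal.exp ((s * r : ℝ) : EReal) := by
    rw [eexp_of_ne_top (ENNReal.mul_ne_top hs' ENNReal.ofReal_ne_top), EReal.exp_coe,
      ← ENNReal.ofReal_mul hs, ENNReal.toReal_ofReal (by positivity)]
  rw [hsr] at hle
  rw [sub_eq_add_neg, EReal.exp_add, EReal.exp_neg, ← div_eq_mul_inv,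
    ENNReal.le_div_iff_mul_le (Or.inl (by rw [Ne, EReal.exp_eq_zero_iff]; exact EReal.coe_ne_bot _))
      (Or.inl (by rw [Ne, EReal.exp_eq_top_iff]; exact EReal.coe_ne_top _))]
  exact hle

/-! ### Integrability below s₀ and the integral against ν*. -/

section Main

variable {Y : Type*} [TopologicalSpace Y] [MeasurableSpace Y] {ρ : Measure Y}
  {F' : Set (Closeds Y)} {Λ : Measure F'}

/-- Below the critical exponent the function `φ(s ρ(K))` is integrable. -/
lemma lintegral_ephi_lt_top (hρ_fin : ∀ K ∈ F', ρ (K : Set Y) < ∞)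
    (hρ_meas : Measurable (fun K : F' => ρ ((K : Closeds Y) : Set Y)))
    (hΛ : ∫⁻ K : F', ρ ((K : Closeds Y) : Set Y) ∂Λ < ∞) {s : ℝ} (hs : 0 < s)
    (hs₀ : ENNReal.ofReal s < sZero ρ Λ) :
    ∫⁻ K : F', ephi (ENNReal.ofReal s * ρ ((K : Closeds Y) : Set Y)) ∂Λ ≠ ∞ := by
  obtain ⟨t, ht⟩ := lt_iSup_iff.mp hs₀
  obtain ⟨⟨-, hfin⟩, hst⟩ := lt_iSup_iff.mp ht
  have hst' : s ≤ t := by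
    have := (ENNReal.ofReal_lt_coe_iff hs.le).mp hst
    exact this.le
  -- Large particles are controlled by e^{tρ(K)} with an admissible t > s, small ones by φ(s ρ(K)) ≤
  -- ρ(K) φ(s) and the integrability of ρ.
  set S : Set F' := {K : F' | 1 < ρ ((K : Closeds Y) : Set Y)} with hS
  have hSm : MeasurableSet S := measurableSet_lt measurable_const hρ_meas
  rw [← lintegral_add_compl _ hSm]
  refine ENNReal.add_ne_top.mpr ⟨ne_top_of_le_ne_top hfin.ne (lintegral_mono fun K => ?_), ?_⟩
  · have hK := (hρ_fin K.1 K.2).ne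
    have hne := ENNReal.mul_ne_top (ENNReal.ofReal_ne_top (r := s)) hK
    have h1 : ephi (ENNReal.ofReal s * ρ ((K : Closeds Y) : Set Y)) ≤
        eexp (ENNReal.ofReal s * ρ ((K : Closeds Y) : Set Y)) := by
      rw [eexp_eq]
      exact le_add_self.trans le_add_self
    refine h1.trans ?_
    rw [eexp_of_ne_top hne, ENNReal.toReal_mul, ENNReal.toReal_ofReal hs.le]
    gcongr
  · have hb : ∫⁻ K in Sᶜ, ephi (ENNReal.ofReal s * ρ ((K : Closeds Y) : Set Y)) ∂Λ ≤
        ∫⁻ K : F', ρ ((K : Closeds Y) : Set Y) * ephi (ENNReal.ofReal s) ∂Λ := by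
      refine le_trans (setLIntegral_mono' hSm.compl fun K hK => ?_)
        (lintegral_mono' Measure.restrict_le_self le_rfl)
      have hK1 : ρ ((K : Closeds Y) : Set Y) ≤ 1 := not_lt.mp hK
      simpa using ephi_mul_le (ENNReal.ofReal_ne_top (r := s)) hK1 ENNReal.one_ne_top
    refine ne_top_of_le_ne_top ?_ hb
    rw [lintegral_mul_const _ hρ_meas]
    refine ENNReal.mul_ne_top hΛ.ne ?_
    rw [ephi, if_neg ENNReal.ofReal_ne_top]
    exact ENNReal.ofReal_ne_top

lemma lintegral_nuStar (hρ_fin : ∀ K ∈ F', ρ (K : Set Y) < ∞)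
    (hρ_meas : Measurable (fun K : F' => ρ ((K : Closeds Y) : Set Y)))
    (hstar : Measurable (rhoStar ρ Λ)) {s : ℝ} (hs : 0 < s) :
    ∫⁻ u : ℝ≥0, ENNReal.ofReal (phi (s * (u : ℝ))) ∂(nuStar ρ Λ) =
      ∫⁻ K : F', rhoStar ρ Λ K * (ephi (ENNReal.ofReal s * ρ ((K : Closeds Y) : Set Y)) /
        ρ ((K : Closeds Y) : Set Y)) ∂Λ := by
  have hphi : Measurable fun u : ℝ≥0 => ENNReal.ofReal (phi (s * (u : ℝ))) := by
    unfold phi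
    fun_prop
  have hdens : Measurable fun K : F' => rhoStar ρ Λ K / ρ ((K : Closeds Y) : Set Y) :=
    hstar.div hρ_meas
  have hcomp : Measurable fun K : F' =>
      ENNReal.ofReal (phi (s * ((ρ ((K : Closeds Y) : Set Y)).toNNReal : ℝ))) :=
    hphi.comp hρ_meas.ennreal_toNNReal
  rw [nuStar, lintegral_map hphi hρ_meas.ennreal_toNNReal,
    lintegral_withDensity_eq_lintegral_mul _ hdens hcomp]
  refine lintegral_congr fun K => ?_
  have hK := (hρ_fin K.1 K.2).ne
  have h1 : ephi (ENNReal.ofReal s * ρ ((K : Closeds Y) : Set Y)) =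
      ENNReal.ofReal (phi (s * ((ρ ((K : Closeds Y) : Set Y)).toNNReal : ℝ))) := by
    rw [ephi, if_neg (ENNReal.mul_ne_top ENNReal.ofReal_ne_top hK), ENNReal.toReal_mul,
      ENNReal.toReal_ofReal hs.le]
    rfl
  rw [h1]
  simp only [Pi.mul_apply, div_eq_mul_inv]
  ring

end Main

end BooleanModel

/-! ### The concentration inequality. -/

theorem mainTheorem1
    {Y : Type*} [TopologicalSpace Y] [T2Space Y] [LocallyCompactSpace Y]
    [SecondCountableTopology Y] [MeasurableSpace Y] [BorelSpace Y]
    (ρ : Measure Y)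
    (F' : Set (Closeds Y)) (hF' : MeasurableSet F')
    (hρ_fin : ∀ K ∈ F', ρ (K : Set Y) < ∞)
    (hρ_meas : Measurable (fun K : F' => ρ ((K : Closeds Y) : Set Y)))
    (hF'_union : ∀ K ∈ F', ∀ L ∈ F', K ⊔ L ∈ F')
    (Λ : Measure F') [SigmaFinite Λ]
    (hΛ : ∫⁻ K : F', ρ ((K : Closeds Y) : Set Y) ∂Λ < ∞)
    (B : ℕ → Set F') (hB_meas : ∀ n, MeasurableSet (B n)) (hB_mono : Monotone B)
    (hB_univ : ⋃ n, B n = Set.univ) (hB_fin : ∀ n, Λ (B n) < ∞)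
    {Ω : Type*} [MeasurableSpace Ω] (P : Measure Ω) [IsProbabilityMeasure P]
    (η : Ω → Measure F') (hη : IsPoissonProcess P Λ η)
    (hs₀ : 0 < sZero ρ Λ) :
    (∀ᵐ ω ∂P, ρ (particleUnion B (η ω)) < ∞) ∧
    Integrable (fun ω => volumeFunctional ρ B (η ω)) P ∧
    ∀ r : ℝ, 0 < r →
      P {ω | r ≤ volumeFunctional ρ B (η ω) - ∫ ω', volumeFunctional ρ B (η ω') ∂P} ≤
        EReal.exp (⨅ s ∈ {s : ℝ | 0 < s ∧ ENNReal.ofReal s < sZero ρ Λ},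
          (((∫⁻ u : ℝ≥0, ENNReal.ofReal (phi (s * (u : ℝ))) ∂(nuStar ρ Λ) : ℝ≥0∞) : EReal)
            - ((s * r : ℝ) : EReal))) := by
  let M := closedsModel ρ F' hρ_fin hρ_meas hF'_union
  have : MeasurableSpace.CountablySeparated F' :=
    MeasurableSpace.Subtype.countablySeparated (h := countablySeparated_closeds)
  have := MeasurableSpace.measurableSingletonClass_of_countablySeparated (α := F')
  have hV := M.aemeasurable_limitVolume hη hB_meas hB_fin
  have hVle : ∫⁻ ω, M.limitVolume B (η ω) ∂P ≠ ∞ :=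
    ne_top_of_le_ne_top hΛ.ne (M.lintegral_limitVolume_le hη hB_meas hB_mono hB_fin)
  have hVlt : ∀ᵐ ω ∂P, M.limitVolume B (η ω) < ∞ := ae_lt_top' hV hVle
  -- Almost surely every `B n` carries finitely many points, so the exceptional empty value is not
  -- used and Z is the increasing union of the restricted models.
  have heq : ∀ᵐ ω ∂P, ρ (particleUnion B (η ω)) = M.limitVolume B (η ω) := by
    have hfin : ∀ᵐ ω ∂P, ∀ n, η ω (B n) < ∞ :=
      ae_all_iff.mpr fun n => hη.ae_lt_top (hB_meas n) (hB_fin n)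
    filter_upwards [hfin] with ω hω
    have hU : particleUnion B (η ω) = ⋃ n, M.atomUnion ((η ω).restrict (B n)) := by
      ext y
      simp only [Set.mem_iUnion]
      constructor
      · rintro ⟨-, K, hK, hy⟩
        obtain ⟨n, hn⟩ := Set.mem_iUnion.mp (hB_univ ▸ Set.mem_univ K)
        refine ⟨n, K, ?_, hy⟩
        rwa [Measure.restrict_apply (measurableSet_singleton K),
          Set.inter_eq_left.mpr (Set.singleton_subset_iff.mpr hn)]
      · rintro ⟨n, K, hK, hy⟩
        exact ⟨hω, K, hK.trans_le (Measure.restrict_apply_le _ _), hy⟩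
    rw [hU, Monotone.measure_iUnion fun m n hmn =>
      M.atomUnion_mono (Measure.restrict_mono (hB_mono hmn) le_rfl)]
    rfl
  have hFV : (fun ω => volumeFunctional ρ B (η ω)) =ᵐ[P]
      fun ω => (M.limitVolume B (η ω)).toReal := by
    filter_upwards [heq] with ω hω
    rw [volumeFunctional, hω]
  refine ⟨?_, ?_, fun r hr => ?_⟩
  · filter_upwards [heq, hVlt] with ω h1 h2
    rwa [h1]
  · exact (integrable_toReal_of_lintegral_ne_top hV hVle).congr hFV.symm
  · have hmean : ∫ ω', volumeFunctional ρ B (η ω') ∂P =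
        (∫⁻ ω, M.limitVolume B (η ω) ∂P).toReal := by
      rw [integral_congr_ae hFV, integral_toReal hV hVlt]
    -- Passing to logarithms in the extended reals moves the bound inside the infimum, also when the
    -- infimum is -∞; it then suffices to treat each s.
    rw [← ENNReal.exp_log (P _), EReal.exp_le_exp_iff]
    refine le_iInf₂ fun s hs => ?_
    rw [← EReal.exp_le_exp_iff, ENNReal.exp_log,
      lintegral_nuStar hρ_fin hρ_meas (M.measurable_volumeStar hB_mono hB_univ hB_fin hΛ.ne) hs.1]
    have hbound := M.lintegral_eexp_limitVolume_le hη hB_meas hB_mono hB_univ hB_fin hΛ.ne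
      ENNReal.ofReal_ne_top (lintegral_ephi_lt_top hρ_fin hρ_meas hΛ hs.1 hs.2)
    -- Almost surely F is the real value of the finite limit volume, so the deviation event lies, up
    -- to a null set, in the event to which Markov's inequality applies.
    refine le_trans (measure_mono_ae ?_)
      (measure_le_of_lintegral_eexp_le hV hVle hs.1.le hr.le hbound)
    filter_upwards [hFV, hVlt] with ω h1 h2 h3
    have h4 : r ≤ volumeFunctional ρ B (η ω) - ∫ ω', volumeFunctional ρ B (η ω') ∂P := h3
    rw [h1, hmean] at h4
    change _ ≤ M.limitVolume B (η ω)
    rw [← ENNReal.ofReal_toReal hVle, ← ENNReal.ofReal_add ENNReal.toReal_nonneg hr.le,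
      ← ENNReal.ofReal_toReal h2.ne]
    exact ENNReal.ofReal_le_ofReal (by linarith)
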